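/- Let $A\subset\mathbb R$ be a finite set with $|A|\ge 2$ and let $d\ge 1$ be an integer. For integers $0\le k\le n$ let $\binom{[n]}{k}=\{x\in\{0,1\}^n:\sum_i x_i=k\}$, and let $\binom{[\infty]}{k}$ be the set of all $x\in\{0,1\}^{\mathbb N}$ with exactly $k$ coordinates equal to $1$. A real function on one of these sets is *$A$-valued* if all its values lie in $A$. A function on $\binom{[n]}{k}$ has *degree $d$* if it agrees on $\binom{[n]}{k}$ with a real polynomial of degree at most $d$ in $x_1,\dots,x_n$; a function on $\binom{[\infty]}{k}$ has *degree $d$* if it has the form $f(x)=\sum_{S\subset\mathbb N,\ |S|\le d}c(S)\prod_{i\in S}x_i$ with real coefficients $c(S)$ (at each $x$ only finitely many summands are nonzero). A function $f$ is an *$m$-junta* if there are a set $J$ of at most $m$ coordinates and a function $g:\{0,1\}^J\to\mathbb R$ such that $f(x)=g(x|_J)$ for all $x$ in its domain. Then there is a least integer $\kappa=\kappa(A,d)$ satisfying all of the following conditions: 1. $\kappa>d$. 2. For all $e\in\{0,\dots,d-1\}$: every univariate real polynomial $P$ of degree at most $d-e$ with $P(0),P(1),\dots,P(\kappa-e)\in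 A$ is constant. 3. For all integers $t\ge 0$ and $r,s\ge 1$ with $t+rs\le d$: every univariate real polynomial $P$ of degree at most $s$ with $P(0),P(1),\dots,P(\lfloor(\kappa-t)/r\rfloor)\in A$ is constant. Moreover, the following hold. * If $k\ge\kappa(A,d)$, then there is a constant $m(A,d,k)$, not depending on $n$, such that for every $n\ge k$ every $A$-valued degree $d$ function on $\binom{[n]}{k}$ is an $m(A,d,k)$-junta. * If $1\le k<\kappa(A,d)$, then for every $m\ge 1$ there exist an $n\ge k$ and an $A$-valued degree $d$ function on $\binom{[n]}{k}$ which is not an $m$-junta. Moreover, there exists an $A$-valued degree $d$ function on $\binom{[\infty]}{k}$ which is not an $m$-junta for any finite $m$. -/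

import Mathlib

namespace JuntaSlice

/-- The slice: all 0/1 vectors indexed by `ι` with exactly `k` coordinates equal to one.
`Slice (Fin n) k` is the slice of weight `k` in `{0,1}^n` (it is empty when `n < k`), and
`Slice ℕ k` is the infinite slice of weight `k`. -/
def Slice (ι : Type) (k : ℕ) : Type :=
  {x : ι → Bool // {i | x i = true}.encard = (k : ℕ∞)}

/-- The `i`-th coordinate of a point of the slice, as a real number `0` or `1`. -/
def Slice.bit {ι : Type} {k : ℕ} (x : Slice ι k) (i : ι) : ℝ :=
  if x.1 i = true then 1 else 0

/-- The function `f` takes all its values in `A`. -/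
def IsValuedIn (A : Finset ℝ) {ι : Type} {k : ℕ} (f : Slice ι k → ℝ) : Prop :=
  ∀ x, f x ∈ A

/-- A function on a finite slice has degree (at most) `d` if it is given by a real polynomial
of total degree at most `d` in the coordinates. -/
def HasDegreeLE (d : ℕ) {n k : ℕ} (f : Slice (Fin n) k → ℝ) : Prop :=
  ∃ P : MvPolynomial (Fin n) ℝ, P.totalDegree ≤ d ∧ ∀ x, f x = MvPolynomial.eval x.bit P

/-- A function on the infinite slice has degree (at most) `d` if it is a possibly infinite sum
of real multiples of monomials `x_S = ∏ i ∈ S, x_i` with `S` finite of size at most `d`.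
At each point of the slice only finitely many of the summands are nonzero. -/
def HasDegreeLEInfinite (d : ℕ) {k : ℕ} (f : Slice ℕ k → ℝ) : Prop :=
  ∃ c : {S : Finset ℕ // S.card ≤ d} → ℝ,
    ∀ x, HasSum (fun S : {S : Finset ℕ // S.card ≤ d} => c S * ∏ i ∈ S.1, x.bit i) (f x)

/-- The function `f` is a `J`-junta: its value is determined by the restriction of the input
to the coordinates in `J`. -/
def IsJuntaOn {ι : Type} {k : ℕ} (J : Finset ι) (f : Slice ι k → ℝ) : Prop :=
  ∃ g : (J → Bool) → ℝ, ∀ x : Slice ι k, f x = g (fun i => x.1 i)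

/-- The function `f` is an `m`-junta: it is a `J`-junta for some `J` of size at most `m`. -/
def IsJunta {ι : Type} {k : ℕ} (m : ℕ) (f : Slice ι k → ℝ) : Prop :=
  ∃ J : Finset ι, J.card ≤ m ∧ IsJuntaOn J f

/-- Every univariate real polynomial of degree at most `s` whose values at `0, 1, …, N` all
lie in `A` is constant. -/
def ForcesConstant (A : Finset ℝ) (s N : ℕ) : Prop :=
  ∀ P : Polynomial ℝ, P.natDegree ≤ s → (∀ i : ℕ, i ≤ N → P.eval (i : ℝ) ∈ A) →
    ∃ c : ℝ, P = Polynomial.C c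

/-- The three conditions whose least solution is `κ(A, d)`. The subtractions and the division
are those of natural numbers; as `e, t ≤ d < κ`, no subtraction is truncated, and the division
is the floor. -/
structure KappaConditions (A : Finset ℝ) (d κ : ℕ) : Prop where
  degree_lt : d < κ
  drop_vars : ∀ e : ℕ, e < d → ForcesConstant A (d - e) (κ - e)
  blocks : ∀ t r s : ℕ, 1 ≤ r → 1 ≤ s → t + r * s ≤ d → ForcesConstant A s ((κ - t) / r)

/-- The threshold `κ(A, d)`: the least `κ` satisfying the three conditions. -/
noncomputable def kappa (A : Finset ℝ) (d : ℕ) : ℕ :=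
  sInf {κ : ℕ | KappaConditions A d κ}

end JuntaSlice

/-! Below the threshold, a polynomial produces a non-junta. Let `P` be nonconstant of degree at most
`s`, violating the block condition for `t, r, s`. Fix `t` coordinates and disjoint blocks of `r`
further coordinates, and take `P` of the number of full blocks if all fixed coordinates are one,
`P(0)` otherwise (`blockFunction`). The degree is at most `t + rs`; a point of weight `k` above the
fixed coordinates has at most `(k - t) / r` full blocks, so the values lie in `A`; and infinitely
many blocks matter. Condition 2 is the case `r = 1` of condition 3, and linear polynomials handle `k
≤ d`, so all `1 ≤ k < κ` are covered (`exists_nonconstant_of_lt_kappa`).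

For `k ≥ κ`, a function not determined by few coordinates has many disjoint pairs whose exchange
changes it (`exists_determining_set_or_sensitive_pairs`). Ramsey's theorem supplies `k`
interchangeable padding coordinates away from these pairs, and padding gives an `A`-valued function
`∑ S ⊆ X, c S` of degree `d` on all sets of size at most `k` (`exists_isBallFunction`). Each pair
meets the support of `c`, so it suffices to bound the number of coordinates occurring there
(`exists_card_relevant_le`).

This reduces to excluding large sunflowers from the support (`exists_card_sunflower_lt`). By
induction on the petal size, few petals are met partially by the support; Ramsey and a free-set
argument leave petals that are never met partially and whose unions have values depending only on
the number of petals. These values are a univariate polynomial in that number, which the block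
condition forces to be constant (`coeff_union_biUnion_eq_zero`). -/

namespace JuntaSlice

open Finset

/-! ### Ramsey's theorem for finite hypergraphs -/

/-- Ramsey's theorem for `j`-subsets, with a separate target size for every colour. -/
theorem exists_ramsey_uniform (q j : ℕ) : ∀ M : Fin q → ℕ, ∃ N : ℕ,
    ∀ (α : Type) [DecidableEq α] (V : Finset α) (χ : Finset α → Fin q), N ≤ #V →
      ∃ a, ∃ H ⊆ V, #H = M a ∧ ∀ T ⊆ H, #T = j → χ T = a := by
  induction j with
  | zero =>
    intro M
    refine ⟨∑ a, M a, fun α _ V χ hV => ?_⟩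
    obtain ⟨H, hH, hc⟩ := exists_subset_card_eq
      ((single_le_sum (fun _ _ => Nat.zero_le _) (mem_univ (χ ∅))).trans hV)
    refine ⟨χ ∅, H, hH, hc, fun T _ h => ?_⟩
    rw [card_eq_zero.mp h]
  | succ j ih =>
    suffices h : ∀ s : ℕ, ∀ M : Fin q → ℕ, ∑ a, M a = s → ∃ N : ℕ,
        ∀ (α : Type) [DecidableEq α] (V : Finset α) (χ : Finset α → Fin q), N ≤ #V →
          ∃ a, ∃ H ⊆ V, #H = M a ∧ ∀ T ⊆ H, #T = j + 1 → χ T = a from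
      fun M => h _ M rfl
    intro s
    induction s with
    | zero =>
      intro M hM
      refine ⟨0, fun α _ V χ _ => ⟨χ ∅, ∅, empty_subset _, ?_, fun T hT hc => ?_⟩⟩
      · rw [sum_eq_zero_iff] at hM
        simp [hM]
      · rw [subset_empty.mp hT] at hc
        simp at hc
    | succ s ihs =>
      intro M hM
      by_cases h0 : ∃ a, M a = 0
      · obtain ⟨a, ha⟩ := h0
        refine ⟨0, fun α _ V χ _ => ⟨a, ∅, empty_subset _, by simp [ha], fun T hT hc => ?_⟩⟩
        rw [subset_empty.mp hT] at hc
        simp at hc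
      · push Not at h0
        -- Erdős–Szekeres recursion: inside a set whose link at `v` has colour `a`, a set of colour
        -- `a` may be one element short, since `v` completes it.
        have hlow : ∀ a, ∑ b, Function.update M a (M a - 1) b = s := by
          intro a
          have h1 := sum_update_of_mem (mem_univ a) M (M a - 1)
          have h2 := add_sum_erase univ M (mem_univ a)
          rw [sdiff_singleton_eq_erase] at h1
          have := h0 a
          omega
        choose R hR using fun a => ihs _ (hlow a)
        -- The colour of the link is not known in advance, so the target dominates every `R a`.
        obtain ⟨N, hN⟩ := ih (fun _ => ∑ a, R a)
        refine ⟨N + 1, fun α _ V χ hV => ?_⟩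
        obtain ⟨v, hv⟩ : V.Nonempty := by
          rw [← card_pos]; omega
        obtain ⟨a, V', hV', hcV', hmono⟩ := hN α (V.erase v) (fun T => χ (insert v T))
          (by rw [card_erase_of_mem hv]; omega)
        obtain ⟨b, H, hH, hcH, hbH⟩ := hR a α V' χ
          (by rw [hcV']; exact single_le_sum (fun _ _ => Nat.zero_le _) (mem_univ a))
        have hHV : H ⊆ V := (hH.trans hV').trans (erase_subset _ _)
        by_cases hba : b = a
        · subst hba
          have hvH : v ∉ H := fun h => by simpa using hV' (hH h)
          refine ⟨b, insert v H, insert_subset hv hHV, ?_, fun T hT hcT => ?_⟩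
          · rw [card_insert_of_notMem hvH, hcH]
            have := h0 b
            simp; omega
          · by_cases hvT : v ∈ T
            · have := hmono (T.erase v) ((subset_insert_iff.mp hT).trans hH)
                (by rw [card_erase_of_mem hvT]; omega)
              rwa [insert_erase hvT] at this
            · exact hbH T ((subset_insert_iff_of_notMem hvT).mp hT) hcT
        · refine ⟨b, H, hHV, ?_, hbH⟩
          rw [hcH, Function.update_of_ne hba]

/-- Ramsey's theorem: for every colouring of the finite subsets with `q` colours, every large set
contains a set of size `M` in which the colour of a subset of size at most `k` depends only on its
size. -/
theorem exists_ramsey (q k M : ℕ) : ∃ N : ℕ, ∀ (α : Type) [DecidableEq α] (K : Type) [Fintype K],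
    Fintype.card K ≤ q → ∀ (V : Finset α) (χ : Finset α → K), N ≤ #V →
      ∃ H ⊆ V, #H = M ∧ ∀ S ⊆ H, ∀ T ⊆ H, #S = #T → #S ≤ k → χ S = χ T := by
  suffices h : ∃ N : ℕ, ∀ (α : Type) [DecidableEq α] (V : Finset α) (χ : Finset α → Fin q),
      N ≤ #V → ∃ H ⊆ V, #H = M ∧ ∀ S ⊆ H, ∀ T ⊆ H, #S = #T → #S ≤ k → χ S = χ T by
    obtain ⟨N, hN⟩ := h
    refine ⟨N, fun α _ K _ hK V χ hV => ?_⟩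
    obtain ⟨e⟩ : Nonempty (K ↪ Fin q) :=
      Function.Embedding.nonempty_of_card_le (by simpa using hK)
    obtain ⟨H, hHV, hc, hH⟩ := hN α V (fun S => e (χ S)) hV
    exact ⟨H, hHV, hc, fun S hS T hT h1 h2 => e.injective (hH S hS T hT h1 h2)⟩
  induction k with
  | zero =>
    refine ⟨M, fun α _ V χ hV => ?_⟩
    obtain ⟨H, hH, hc⟩ := exists_subset_card_eq hV
    refine ⟨H, hH, hc, fun S _ T _ h h0 => ?_⟩
    have hS : S = ∅ := card_eq_zero.mp (by omega)
    have hT : T = ∅ := card_eq_zero.mp (by omega)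
    rw [hS, hT]
  | succ k ih =>
    obtain ⟨N, hN⟩ := ih
    obtain ⟨N', hN'⟩ := exists_ramsey_uniform q (k + 1) (fun _ => N)
    refine ⟨N', fun α _ V χ hV => ?_⟩
    obtain ⟨a, V', hV', hc', ha⟩ := hN' α V χ hV
    obtain ⟨H, hH, hc, hmono⟩ := hN α V' χ hc'.ge
    refine ⟨H, hH.trans hV', hc, fun S hS T hT h hk => ?_⟩
    rcases hk.lt_or_eq with hk | hk
    · exact hmono S hS T hT h (by omega)
    · rw [ha S (hS.trans hH) hk, ha T (hT.trans hH) (h ▸ hk)]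

/-! ### The threshold -/

theorem ForcesConstant.mono {A : Finset ℝ} {s N N' : ℕ} (h : ForcesConstant A s N) (hN : N ≤ N') :
    ForcesConstant A s N' :=
  fun P hP hv => h P hP fun i hi => hv i (hi.trans hN)

/-- By pigeonhole, among more than `#A * s` points some value is taken more than `s` times. -/
theorem forcesConstant_of_card_mul_le {A : Finset ℝ} {s N : ℕ} (h : #A * s ≤ N) :
    ForcesConstant A s N := by
  intro P hP hv
  obtain ⟨a, -, ha⟩ := exists_lt_card_fiber_of_mul_lt_card_of_maps_to
    (s := range (N + 1)) (t := A) (f := fun i : ℕ => P.eval (i : ℝ)) (n := s)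
    (fun i hi => hv i (by simpa [Nat.lt_succ_iff] using hi)) (by simpa using by omega)
  refine ⟨a, sub_eq_zero.mp ?_⟩
  refine Polynomial.eq_zero_of_natDegree_lt_card_of_eval_eq_zero' _
    (({x ∈ range (N + 1) | P.eval (x : ℝ) = a} : Finset ℕ).image (fun i : ℕ => (i : ℝ))) ?_ ?_
  · intro x hx
    obtain ⟨i, hi, rfl⟩ := mem_image.mp hx
    simp [(mem_filter.mp hi).2]
  · rw [card_image_of_injective _ Nat.cast_injective, Polynomial.natDegree_sub_C]
    exact hP.trans_lt ha

theorem exists_kappaConditions (A : Finset ℝ) (d : ℕ) : ∃ κ, KappaConditions A d κ := by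
  have key : ∀ t r s : ℕ, 1 ≤ r → t ≤ d → r ≤ d → s ≤ d →
      ForcesConstant A s ((d + 1 + d * (#A * d) - t) / r) := by
    intro t r s hr ht hrd hs
    apply forcesConstant_of_card_mul_le
    rw [Nat.le_div_iff_mul_le hr]
    have h1 : #A * s * r ≤ #A * d * d := by gcongr
    have h2 : d * (#A * d) = #A * d * d := by ring
    omega
  refine ⟨d + 1 + d * (#A * d), by omega, fun e he => ?_, fun t r s hr hs h => ?_⟩
  · simpa using key e 1 (d - e) le_rfl he.le (by omega) (by omega)
  · exact key t r s hr (by omega) (by nlinarith) (by nlinarith)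

/-- Thanks to upward closure, the junta bound can be proved with `k` itself in place of the
threshold. -/
theorem KappaConditions.mono {A : Finset ℝ} {d κ k : ℕ} (h : KappaConditions A d κ) (hk : κ ≤ k) :
    KappaConditions A d k where
  degree_lt := h.degree_lt.trans_le hk
  drop_vars e he := (h.drop_vars e he).mono (Nat.sub_le_sub_right hk e)
  blocks t r s hr hs hd := (h.blocks t r s hr hs hd).mono
    (Nat.div_le_div_right (Nat.sub_le_sub_right hk t))

theorem isLeast_kappa (A : Finset ℝ) (d : ℕ) :
    IsLeast {κ : ℕ | KappaConditions A d κ} (kappa A d) :=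
  ⟨Nat.sInf_mem (exists_kappaConditions A d), fun _ h => Nat.sInf_le h⟩

/-- Below the threshold, the block condition fails for blocks that fit into the slice. -/
theorem exists_nonconstant_of_lt_kappa {A : Finset ℝ} (hA : 2 ≤ #A) {d k : ℕ} (hk : 1 ≤ k)
    (hkd : k < kappa A d) :
    ∃ t r s : ℕ, 1 ≤ r ∧ t + r * s ≤ d ∧ t + r * s ≤ k ∧ ∃ P : Polynomial ℝ, P.natDegree ≤ s ∧
      (∀ i : ℕ, i ≤ (k - t) / r → P.eval (i : ℝ) ∈ A) ∧ ¬ ∃ c : ℝ, P = Polynomial.C c := by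
  by_cases hle : k ≤ d
  · obtain ⟨a, ha, b, hb, hab⟩ := one_lt_card.mp hA
    -- With `t = k - 1` and `r = 1` only the values at `0` and `1` matter, and a line takes any two
    -- values there.
    refine ⟨k - 1, 1, 1, le_rfl, by omega, by omega,
      Polynomial.C a + Polynomial.C (b - a) * Polynomial.X, ?_, ?_, ?_⟩
    · compute_degree
    · intro i hi
      have : i = 0 ∨ i = 1 := by
        rw [Nat.div_one] at hi
        omega
      rcases this with rfl | rfl <;> simp [ha, hb]
    · rintro ⟨c, hc⟩
      have h0 := congrArg (Polynomial.eval 0) hc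
      have h1 := congrArg (Polynomial.eval 1) hc
      simp at h0 h1
      exact hab (h0.trans h1.symm)
  · by_contra hcon
    push Not at hcon
    have hb : ∀ t r s : ℕ, 1 ≤ r → 1 ≤ s → t + r * s ≤ d → ForcesConstant A s ((k - t) / r) :=
      fun t r s hr _ h P hP hv => hcon t r s hr h (by omega) P hP hv
    refine absurd ((isLeast_kappa A d).2 (show KappaConditions A d k from
      ⟨by omega, fun e he => ?_, hb⟩)) (by omega)
    simpa using hb e 1 (d - e) le_rfl (by omega) (by omega)

/-! ### Homogeneous set functions of bounded degree -/

/-- Isolates the top term, so that an induction on size can read off `b L` from the sum over its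
subsets. -/
theorem sum_powerset_eq_add_sub {α : Type} [DecidableEq α] {b : Finset α → ℝ} {β : ℕ → ℝ}
    {L : Finset α} (h : ∀ R ⊂ L, b R = β #R) :
    ∑ R ∈ L.powerset, b R = b L - β #L + ∑ R ∈ L.powerset, β #R := by
  have hL : L ∈ L.powerset := mem_powerset_self L
  rw [← add_sum_erase _ b hL, ← add_sum_erase _ (fun R => β #R) hL]
  have : ∑ R ∈ L.powerset.erase L, b R = ∑ R ∈ L.powerset.erase L, β #R :=
    sum_congr rfl fun R hR => h R (mem_ssubsets.mp hR)
  rw [this]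
  ring

/-- If the sums of `b` over the subsets of `L` depend only on the size of `L`, so does `b`. -/
theorem exists_eq_card_of_sum_powerset {α : Type} [DecidableEq α] {H : Finset α}
    {b : Finset α → ℝ} {N : ℕ}
    (hh : ∀ L ⊆ H, ∀ L' ⊆ H, #L = #L' → #L ≤ N →
      ∑ R ∈ L.powerset, b R = ∑ R ∈ L'.powerset, b R) :
    ∃ β : ℕ → ℝ, ∀ L ⊆ H, #L ≤ N → b L = β #L := by
  suffices h : ∀ q ≤ N + 1, ∃ β : ℕ → ℝ, ∀ L ⊆ H, #L < q → b L = β #L by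
    obtain ⟨β, hβ⟩ := h (N + 1) le_rfl
    exact ⟨β, fun L hL hc => hβ L hL (by omega)⟩
  intro q
  induction q with
  | zero => exact fun _ => ⟨fun _ => 0, fun L _ h => absurd h (by omega)⟩
  | succ q ih =>
    intro hq
    obtain ⟨β, hβ⟩ := ih (by omega)
    by_cases hex : ∃ L₀ ⊆ H, #L₀ = q
    · obtain ⟨L₀, hL₀, hc₀⟩ := hex
      refine ⟨Function.update β q (b L₀), fun L hL hc => ?_⟩
      rcases (Nat.lt_succ_iff.mp hc).lt_or_eq with hlt | heq
      · rw [Function.update_of_ne hlt.ne]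
        exact hβ L hL hlt
      · rw [heq, Function.update_self]
        have h1 := sum_powerset_eq_add_sub (b := b) (β := β) (L := L) fun R hR =>
          hβ R (hR.1.trans hL) (heq ▸ card_lt_card hR)
        have h2 := sum_powerset_eq_add_sub (b := b) (β := β) (L := L₀) fun R hR =>
          hβ R (hR.1.trans hL₀) (hc₀ ▸ card_lt_card hR)
        rw [sum_powerset_apply_card β] at h1 h2
        have h3 := hh L hL L₀ hL₀ (heq.trans hc₀.symm) (by omega)
        rw [h1, h2, heq, hc₀] at h3
        linarith
    · refine ⟨β, fun L hL hc => hβ L hL ?_⟩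
      rcases (Nat.lt_succ_iff.mp hc).lt_or_eq with hlt | heq
      · exact hlt
      · exact absurd ⟨L, hL, heq⟩ hex

/-- A symmetric `A`-valued set function of degree at most `s` on the subsets of size at most `N`
is constant if univariate polynomials of degree at most `s` are. -/
theorem coeff_eq_zero_of_homogeneous {A : Finset ℝ} {s N : ℕ}
    (hF : s ≠ 0 → ForcesConstant A s N) {α : Type} [DecidableEq α] {H : Finset α} (hH : N ≤ #H)
    {b : Finset α → ℝ} {K : ℝ} (hb : ∀ L ⊆ H, s < #L → b L = 0)
    (hA : ∀ L ⊆ H, #L ≤ N → K + ∑ R ∈ L.powerset, b R ∈ A)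
    (hh : ∀ L ⊆ H, ∀ L' ⊆ H, #L = #L' → #L ≤ N →
      ∑ R ∈ L.powerset, b R = ∑ R ∈ L'.powerset, b R) :
    ∀ L ⊆ H, L.Nonempty → #L ≤ N → b L = 0 := by
  rcases eq_or_ne s 0 with rfl | hs
  · exact fun L hL hne _ => hb L hL hne.card_pos
  obtain ⟨β, hβ⟩ := exists_eq_card_of_sum_powerset hh
  have hβ0 : ∀ j ≤ N, s < j → β j = 0 := by
    intro j hj hsj
    obtain ⟨L, hL, hc⟩ := exists_subset_card_eq (hj.trans hH)
    have h1 := hβ L hL (hc ▸ hj)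
    rw [hb L hL (hc ▸ hsj), hc] at h1
    exact h1.symm
  have hsum : ∀ L ⊆ H, #L ≤ N →
      ∑ R ∈ L.powerset, b R = ∑ j ∈ range (s + 1), ((#L).choose j : ℝ) * β j := by
    intro L hL hc
    rw [sum_congr rfl fun R hR => hβ R ((mem_powerset.mp hR).trans hL)
      ((card_le_card (mem_powerset.mp hR)).trans hc), sum_powerset_apply_card β]
    simp only [nsmul_eq_mul]
    rw [sum_subset (range_mono (show #L + 1 ≤ #L + s + 1 by omega)) fun j _ hj => ?_,
      ← sum_subset (range_mono (show s + 1 ≤ #L + s + 1 by omega)) fun j _ hj => ?_]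
    · simp only [mem_range] at hj
      by_cases hjL : j ≤ #L
      · rw [hβ0 j (by omega) (by omega), mul_zero]
      · rw [Nat.choose_eq_zero_of_lt (by omega), Nat.cast_zero, zero_mul]
    · simp only [mem_range] at hj
      rw [Nat.choose_eq_zero_of_lt (by omega), Nat.cast_zero, zero_mul]
  -- Newton's form: `descPochhammer ℝ j / j!` takes the value `(#L).choose j` at `#L`.
  set P : Polynomial ℝ := Polynomial.C K +
    ∑ j ∈ range (s + 1), Polynomial.C (β j / j.factorial) * descPochhammer ℝ j with hP
  have hdeg : P.natDegree ≤ s := by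
    refine Polynomial.natDegree_add_le_of_degree_le (by simp) ?_
    refine Polynomial.natDegree_sum_le_of_forall_le _ _ fun j hj => ?_
    refine (Polynomial.natDegree_C_mul_le _ _).trans ?_
    rw [descPochhammer_natDegree]
    simpa [Nat.lt_succ_iff] using hj
  have heval : ∀ L ⊆ H, #L ≤ N → P.eval ((#L : ℕ) : ℝ) = K + ∑ R ∈ L.powerset, b R := by
    intro L hL hc
    rw [hsum L hL hc, hP]
    simp only [Polynomial.eval_add, Polynomial.eval_C, Polynomial.eval_finsetSum,
      Polynomial.eval_mul, descPochhammer_eval_eq_descFactorial]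
    congr 1
    refine sum_congr rfl fun j _ => ?_
    rw [Nat.descFactorial_eq_factorial_mul_choose]
    push_cast
    have : (j.factorial : ℝ) ≠ 0 := by positivity
    field_simp
  obtain ⟨c, hc⟩ := hF hs P hdeg fun i hi => by
    obtain ⟨L, hL, rfl⟩ := exists_subset_card_eq (hi.trans hH)
    rw [heval L hL hi]
    exact hA L hL hi
  have hconst : ∀ L ⊆ H, #L ≤ N → ∑ R ∈ L.powerset, b R = b ∅ := by
    intro L hL hcL
    have h1 := heval L hL hcL
    have h2 := heval ∅ (empty_subset _) (by simp)
    rw [hc, Polynomial.eval_C] at h1 h2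
    rw [powerset_empty, sum_singleton] at h2
    linarith
  intro L
  induction L using Finset.strongInduction with
  | H L ih =>
    intro hL hne hcL
    have h1 := hconst L hL hcL
    rw [sum_eq_add (a := L) (b := ∅) hne.ne_empty (fun R hR h => ?_)
      (fun h => absurd (mem_powerset_self L) h)
      (fun h => absurd (empty_mem_powerset L) h)] at h1
    · linarith
    · have hRL := mem_powerset.mp hR
      exact ih R (hRL.ssubset_of_ne h.1) (hRL.trans hL) (nonempty_iff_ne_empty.mpr h.2)
        ((card_le_card hRL).trans hcL)

/-! ### Functions of bounded degree on a ball -/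

/-- The coefficients `c` define a function `X ↦ ∑ S ⊆ X, c S` of degree at most `d` which is
`A`-valued on the sets of size at most `k`. -/
structure IsBallFunction (A : Finset ℝ) (d k : ℕ) {ι : Type} (c : Finset ι → ℝ) : Prop where
  degree : ∀ S, c S ≠ 0 → #S ≤ d
  mem : ∀ X, #X ≤ k → ∑ S ∈ X.powerset, c S ∈ A

/-- A set mapping with small values has a free set of any given size in a large set. -/
theorem exists_free_set {α : Type} [DecidableEq α] {H : Finset α} {Φ : Finset α → Finset α}
    {D q : ℕ} (hΦ : ∀ T ⊆ H, #T = q → #(Φ T) ≤ D) (hH : (q + 1) * D + q < #H) :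
    ∃ L ⊆ H, #L = q + 1 ∧ ∀ l ∈ L, l ∉ Φ (L.erase l) := by
  by_contra hcon
  push Not at hcon
  obtain ⟨a, -⟩ : H.Nonempty := card_pos.mp (by omega)
  have : Nonempty α := ⟨a⟩
  -- If every `(q + 1)`-set `L` had a bad element `g L`, then `L ↦ (L \ {g L}, g L)` would be
  -- injective, so that `(#H).choose (q + 1) ≤ (#H).choose q * D`, which is false for large `#H`.
  choose! g hg hgΦ using hcon
  have h1 : #(H.powersetCard (q + 1)) ≤ #((H.powersetCard q).sigma Φ) := by
    refine card_le_card_of_injOn (fun L => ⟨L.erase (g L), g L⟩) (fun L hL => ?_) ?_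
    · obtain ⟨hL, hc⟩ := mem_powersetCard.mp hL
      simp only [coe_sigma, Set.mem_sigma_iff, mem_coe, mem_powersetCard]
      exact ⟨⟨(erase_subset _ _).trans hL, by rw [card_erase_of_mem (hg L hL hc), hc]; rfl⟩,
        hgΦ L hL hc⟩
    · intro L hL L' hL' h
      obtain ⟨hL, hc⟩ := mem_powersetCard.mp hL
      obtain ⟨hL', hc'⟩ := mem_powersetCard.mp hL'
      simp only [Sigma.mk.injEq, heq_eq_eq] at h
      rw [← insert_erase (hg L hL hc), ← insert_erase (hg L' hL' hc'), h.1, h.2]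
  have h2 : #((H.powersetCard q).sigma Φ) ≤ (#H).choose q * D := by
    rw [card_sigma, ← card_powersetCard, ← smul_eq_mul]
    exact sum_le_card_nsmul _ _ _ fun T hT =>
      hΦ T (mem_powersetCard.mp hT).1 (mem_powersetCard.mp hT).2
  rw [card_powersetCard] at h1
  have h3 := Nat.choose_succ_right_eq (#H) q
  have h4 : 0 < (#H).choose q := Nat.choose_pos (by omega)
  have h5 : (#H).choose q * (#H - q) ≤ (#H).choose q * ((q + 1) * D) := by
    rw [← h3]
    calc _ ≤ (#H).choose q * D * (q + 1) := Nat.mul_le_mul_right _ (h1.trans h2)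
      _ = _ := by ring
  have := Nat.le_of_mul_le_mul_left h5 h4
  omega

section Petals

variable {ι α : Type} [DecidableEq ι] {C : Finset ι} {U : α → Finset ι}
  {H : Finset α} {r : ℕ}

theorem card_union_biUnion (hdisj : (H : Set α).PairwiseDisjoint U)
    (hC : ∀ l ∈ H, Disjoint C (U l)) (hr : ∀ l ∈ H, #(U l) = r) {C' : Finset ι} (hC' : C' ⊆ C)
    {L : Finset α} (hL : L ⊆ H) : #(C' ∪ L.biUnion U) = #C' + r * #L := by
  rw [card_union_of_disjoint, card_biUnion, sum_congr rfl fun l hl => hr l (hL hl), sum_const,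
    smul_eq_mul, mul_comm]
  · exact hdisj.subset hL
  · rw [disjoint_biUnion_right]
    exact fun l hl => (hC l (hL hl)).mono_left hC'

/-- If no set in the support of `c` meets a petal partially, then the support inside a union of
petals and a part of the core consists of such unions. -/
theorem sum_powerset_union_biUnion [DecidableEq α] (hdisj : (H : Set α).PairwiseDisjoint U)
    (hC : ∀ l ∈ H, Disjoint C (U l)) (hr : ∀ l ∈ H, #(U l) = r) (hr1 : 1 ≤ r) {d : ℕ}
    {c : Finset ι → ℝ} (hdeg : ∀ S, c S ≠ 0 → #S ≤ d)
    (hfree : ∀ L ⊆ H, #L ≤ d → ∀ l ∈ L, ∀ S ⊆ C ∪ (L.erase l).biUnion U, ∀ B ⊆ U l,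
      B.Nonempty → B ≠ U l → c (S ∪ B) = 0)
    {C' : Finset ι} (hC' : C' ⊆ C) {L : Finset α} (hL : L ⊆ H) :
    ∑ S ∈ (C' ∪ L.biUnion U).powerset, c S =
      ∑ D ∈ C'.powerset, ∑ R ∈ L.powerset, c (D ∪ R.biUnion U) := by
  rw [← sum_product']
  symm
  have hne : ∀ l ∈ H, (U l).Nonempty := fun l hl => card_pos.mp (by rw [hr l hl]; omega)
  have hcore : ∀ D ⊆ C, ∀ R ⊆ H, (D ∪ R.biUnion U) ∩ C = D := by
    intro D hD R hR
    ext i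
    simp only [mem_inter, mem_union, mem_biUnion]
    constructor
    · rintro ⟨h | ⟨l, hl, hi⟩, hiC⟩
      · exact h
      · exact absurd hi (disjoint_left.mp (hC l (hR hl)) hiC)
    · exact fun h => ⟨Or.inl h, hD h⟩
  have hpet : ∀ D ⊆ C, ∀ R ⊆ H, ∀ l ∈ H, U l ⊆ D ∪ R.biUnion U ↔ l ∈ R := by
    intro D hD R hR l hl
    constructor
    · intro h
      obtain ⟨i, hi⟩ := hne l hl
      rcases mem_union.mp (h hi) with h | h
      · exact absurd hi (disjoint_left.mp (hC l hl) (hD h))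
      · obtain ⟨l', hl', hi'⟩ := mem_biUnion.mp h
        rwa [hdisj.elim_finset hl (hR hl') i hi hi']
    · exact fun h => (subset_biUnion_of_mem U h).trans subset_union_right
  refine sum_bij_ne_zero (fun p _ _ => p.1 ∪ p.2.biUnion U) ?_ ?_ ?_ (fun _ _ _ => rfl)
  · intro p hp _
    simp only [mem_product, mem_powerset] at hp ⊢
    exact union_subset_union hp.1 (biUnion_subset_biUnion_of_subset_left _ hp.2)
  · intro p hp _ p' hp' _ h
    simp only [mem_product, mem_powerset] at hp hp'
    refine Prod.ext ?_ ?_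
    · rw [← hcore p.1 (hp.1.trans hC') p.2 (hp.2.trans hL), h,
        hcore p'.1 (hp'.1.trans hC') p'.2 (hp'.2.trans hL)]
    · ext l
      constructor <;> intro hl
      · have hlH := hL (hp.2 hl)
        rwa [← hpet p'.1 (hp'.1.trans hC') p'.2 (hp'.2.trans hL) l hlH, ← h,
          hpet p.1 (hp.1.trans hC') p.2 (hp.2.trans hL) l hlH]
      · have hlH := hL (hp'.2 hl)
        rwa [← hpet p.1 (hp.1.trans hC') p.2 (hp.2.trans hL) l hlH, h,
          hpet p'.1 (hp'.1.trans hC') p'.2 (hp'.2.trans hL) l hlH]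
  · intro S hS hcS
    rw [mem_powerset] at hS
    -- For surjectivity, `R` collects the petals met by `S`. They are disjoint, so there are at most
    -- `#S ≤ d` of them, as `hfree` requires.
    set R : Finset α := {l ∈ L | (S ∩ U l).Nonempty} with hR
    have hRL : R ⊆ L := filter_subset _ _
    have hRcard : #R ≤ d := by
      refine le_trans ?_ (hdeg S hcS)
      calc #R ≤ #(R.biUnion fun l => S ∩ U l) := card_le_card_biUnion
            (fun l hl l' hl' h => ((hdisj (hL (hRL hl)) (hL (hRL hl')) h).mono
              inter_subset_right inter_subset_right)) (fun l hl => (mem_filter.mp hl).2)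
        _ ≤ #S := card_le_card (biUnion_subset.mpr fun l _ => inter_subset_left)
    have hmemR : ∀ i ∈ S, i ∉ C' → ∃ l ∈ R, i ∈ U l := by
      intro i hi hiC
      rcases mem_union.mp (hS hi) with h | h
      · exact absurd h hiC
      · obtain ⟨l, hl, hil⟩ := mem_biUnion.mp h
        exact ⟨l, mem_filter.mpr ⟨hl, i, mem_inter.mpr ⟨hi, hil⟩⟩, hil⟩
    have hfull : ∀ l ∈ R, U l ⊆ S := by
      intro l hl
      by_contra hnot
      refine hcS ?_
      have hcov : S \ U l ∪ S ∩ U l = S := sdiff_union_inter S (U l)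
      rw [← hcov]
      refine hfree R (hRL.trans hL) hRcard l hl _ ?_ _ inter_subset_right (mem_filter.mp hl).2 ?_
      · intro i hi
        obtain ⟨hiS, hil⟩ := mem_sdiff.mp hi
        by_cases hiC : i ∈ C'
        · exact mem_union_left _ (hC' hiC)
        · obtain ⟨l', hl', hil'⟩ := hmemR i hiS hiC
          refine mem_union_right _ (mem_biUnion.mpr ⟨l', mem_erase.mpr ⟨?_, hl'⟩, hil'⟩)
          rintro rfl
          exact hil hil'
      · intro h
        exact hnot (h ▸ inter_subset_left)
    have hSeq : S ∩ C' ∪ R.biUnion U = S := by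
      ext i
      simp only [mem_union, mem_inter, mem_biUnion]
      constructor
      · rintro (h | ⟨l, hl, hil⟩)
        · exact h.1
        · exact hfull l hl hil
      · intro hi
        by_cases hiC : i ∈ C'
        · exact Or.inl ⟨hi, hiC⟩
        · exact Or.inr (hmemR i hi hiC)
    refine ⟨(S ∩ C', R), ?_, ?_, ?_⟩
    · simp only [mem_product, mem_powerset]
      exact ⟨inter_subset_right, hRL⟩
    · simpa only [hSeq] using hcS
    · exact hSeq

/-- In a homogeneous system of petals that is free of partially met petals, no nonempty union of
petals and a part of the core lies in the support. -/
theorem coeff_union_biUnion_eq_zero [DecidableEq α] (hdisj : (H : Set α).PairwiseDisjoint U)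
    (hC : ∀ l ∈ H, Disjoint C (U l)) (hr : ∀ l ∈ H, #(U l) = r) (hr1 : 1 ≤ r)
    {A : Finset ℝ} {d k : ℕ} (hk : KappaConditions A d k) {c : Finset ι → ℝ}
    (hc : IsBallFunction A d k c) (hCd : #C ≤ d) (hH : k ≤ #H)
    (hfree : ∀ L ⊆ H, #L ≤ d → ∀ l ∈ L, ∀ S ⊆ C ∪ (L.erase l).biUnion U, ∀ B ⊆ U l,
      B.Nonempty → B ≠ U l → c (S ∪ B) = 0)
    (hhom : ∀ C' ⊆ C, ∀ L ⊆ H, ∀ L' ⊆ H, #L = #L' → #C' + r * #L ≤ k →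
      ∑ S ∈ (C' ∪ L.biUnion U).powerset, c S = ∑ S ∈ (C' ∪ L'.biUnion U).powerset, c S) :
    ∀ C' ⊆ C, ∀ L ⊆ H, L.Nonempty → c (C' ∪ L.biUnion U) = 0 := by
  intro C'
  induction C' using Finset.strongInduction with
  | H C' ih =>
    intro hC'
    have hdk := hk.degree_lt
    have hC'd : #C' ≤ d := (card_le_card hC').trans hCd
    have hN : ∀ L : Finset α, #L ≤ (k - #C') / r ↔ #C' + r * #L ≤ k := by
      intro L
      rw [Nat.le_div_iff_mul_le hr1, mul_comm]
      omega
    -- By induction, a proper part `D` of `C'` contributes only `c D`, so all dependence on `L`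
    -- comes from the sets containing all of `C'`.
    have hsum : ∀ L ⊆ H, ∑ S ∈ (C' ∪ L.biUnion U).powerset, c S =
        ∑ D ∈ C'.ssubsets, c D + ∑ R ∈ L.powerset, c (C' ∪ R.biUnion U) := by
      intro L hL
      rw [sum_powerset_union_biUnion hdisj hC hr hr1 hc.degree hfree hC' hL,
        ← sum_erase_add _ _ (mem_powerset_self C')]
      congr 1
      refine sum_congr rfl fun D hD => ?_
      have hD' := mem_ssubsets.mp hD
      rw [sum_eq_single ∅]
      · simp
      · intro R hR hne
        exact ih D hD' (hD'.1.trans hC') R ((mem_powerset.mp hR).trans hL)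
          (nonempty_iff_ne_empty.mpr hne)
      · exact fun h => absurd (empty_mem_powerset L) h
    have key := coeff_eq_zero_of_homogeneous (A := A) (s := (d - #C') / r) (N := (k - #C') / r)
      (H := H) (b := fun R => c (C' ∪ R.biUnion U)) (K := ∑ D ∈ C'.ssubsets, c D) ?_ ?_ ?_ ?_ ?_
    · intro L hL hne
      by_cases hLN : #L ≤ (k - #C') / r
      · exact key L hL hne hLN
      -- Here the union has more than `k > d` elements, so the degree bound already kills the
      -- coefficient.
      · by_contra hcon
        have := hc.degree _ hcon
        rw [card_union_biUnion hdisj hC hr hC' hL] at this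
        exact hLN ((hN L).mpr (by omega))
    · intro hs
      refine hk.blocks _ _ _ hr1 (Nat.one_le_iff_ne_zero.mpr hs) ?_
      have := Nat.mul_div_le (d - #C') r
      omega
    · exact (Nat.div_le_self _ _).trans ((Nat.sub_le _ _).trans hH)
    · intro L hL hlt
      by_contra hcon
      have := hc.degree _ hcon
      rw [card_union_biUnion hdisj hC hr hC' hL] at this
      rw [Nat.div_lt_iff_lt_mul hr1, mul_comm] at hlt
      omega
    · intro L hL hLN
      rw [← hsum L hL]
      refine hc.mem _ ?_
      rw [card_union_biUnion hdisj hC hr hC' hL]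
      exact (hN L).mp hLN
    · intro L hL L' hL' hcard hLN
      have := hhom C' hC' L hL L' hL' hcard ((hN L).mp hLN)
      rw [hsum L hL, hsum L' hL'] at this
      linarith

end Petals

/-! ### Bounding the support -/

/-- The coefficients of an `A`-valued function of degree `d` on a ball do not contain large
sunflowers. -/
theorem exists_card_sunflower_lt {A : Finset ℝ} {d k : ℕ} (hk : KappaConditions A d k) :
    ∀ r : ℕ, 1 ≤ r → ∃ N : ℕ, ∀ (ι α : Type) [DecidableEq ι] [DecidableEq α] (c : Finset ι → ℝ),
      IsBallFunction A d k c → ∀ (C : Finset ι) (U : α → Finset ι) (I : Finset α),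
      (I : Set α).PairwiseDisjoint U → (∀ l ∈ I, Disjoint C (U l)) → (∀ l ∈ I, #(U l) = r) →
      (∀ l ∈ I, c (C ∪ U l) ≠ 0) → #I < N := by
  intro r
  induction r using Nat.strong_induction_on with
  | _ r ih =>
  intro hr1
  choose! N hN using ih
  -- The power of two bounds the number of subsets `S` of the core and at most `d` petals; for each
  -- `S` and each size `b < r` of a partial petal, the inductive bound is `N b`.
  set D : ℕ := 2 ^ (d + r * d) * ∑ b ∈ Ico 1 r, N b with hD
  set M : ℕ := d * D + d + k + 1 with hM
  obtain ⟨R, hR⟩ := exists_ramsey (2 * #A ^ 2 ^ d) k M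
  refine ⟨R + 1, fun ι α _ _ c hc C U I hdisj hC hr hne => ?_⟩
  by_contra hge
  classical
  have hdk := hk.degree_lt
  have hcardC : #C ≤ d := by
    obtain ⟨l, hl⟩ : I.Nonempty := card_pos.mp (by omega)
    exact (card_le_card subset_union_left).trans (hc.degree _ (hne l hl))
  let Bad (T : Finset α) (l : α) : Prop := ∃ S ⊆ C ∪ T.biUnion U, ∃ B ⊆ U l,
    B.Nonempty ∧ B ≠ U l ∧ c (S ∪ B) ≠ 0
  have a₀ : A := ⟨_, hc.mem ∅ (by simp)⟩
  -- The colour records whether some petal of `L` is met partially and all values at `L` joined with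
  -- parts of the core. The default `a₀` is irrelevant: inside the ball every value lies in `A`.
  let χ (L : Finset α) : Prop × ({T // T ∈ C.powerset} → A) :=
    (∃ l ∈ L, Bad (L.erase l) l, fun T =>
      if h : ∑ S ∈ (T.1 ∪ L.biUnion U).powerset, c S ∈ A then ⟨_, h⟩ else a₀)
  obtain ⟨H, hHI, hHM, hH⟩ := hR α (Prop × ({T // T ∈ C.powerset} → A)) (by
    rw [Fintype.card_prod, Fintype.card_prop, Fintype.card_fun, Fintype.card_coe,
      Fintype.card_coe, card_powerset]
    refine Nat.mul_le_mul_left _ (Nat.pow_le_pow_right (card_pos.mpr ⟨_, a₀.2⟩) ?_)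
    exact Nat.pow_le_pow_right (by norm_num) hcardC) I χ (by omega)
  replace hdisj := hdisj.subset hHI
  replace hC : ∀ l ∈ H, Disjoint C (U l) := fun l hl => hC l (hHI hl)
  replace hr : ∀ l ∈ H, #(U l) = r := fun l hl => hr l (hHI hl)
  have hcount : ∀ T ⊆ H, #T ≤ d → #({l ∈ H | l ∉ T ∧ Bad T l}) ≤ D := by
    intro T hT hTd
    have hcov : ({l ∈ H | l ∉ T ∧ Bad T l} : Finset α) ⊆ (C ∪ T.biUnion U).powerset.biUnion fun S =>
        (Ico 1 r).biUnion fun b => {l ∈ H | l ∉ T ∧ ∃ B ⊆ U l, #B = b ∧ c (S ∪ B) ≠ 0} := by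
      intro l hl
      obtain ⟨hlH, hlT, S, hS, B, hB, hBne, hBU, hcB⟩ := mem_filter.mp hl
      simp only [mem_biUnion, mem_powerset, mem_Ico, mem_filter]
      refine ⟨S, hS, #B, ⟨hBne.card_pos, ?_⟩, hlH, hlT, B, hB, rfl, hcB⟩
      rw [← hr l hlH]
      exact card_lt_card (hB.ssubset_of_ne hBU)
    refine (card_le_card hcov).trans ?_
    have hS : #(C ∪ T.biUnion U).powerset ≤ 2 ^ (d + r * d) := by
      rw [card_powerset, card_union_biUnion hdisj hC hr subset_rfl hT]
      gcongr
      norm_num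
    refine (card_biUnion_le_card_mul _ _ (∑ b ∈ Ico 1 r, N b) fun S hS => ?_).trans
      (Nat.mul_le_mul_right _ hS)
    refine card_biUnion_le.trans (sum_le_sum fun b hb => ?_)
    obtain ⟨hb1, hbr⟩ := mem_Ico.mp hb
    set Z : Finset α := {l ∈ H | l ∉ T ∧ ∃ B ⊆ U l, #B = b ∧ c (S ∪ B) ≠ 0} with hZ
    have hZp : ∀ l ∈ Z, ∃ B ⊆ U l, #B = b ∧ c (S ∪ B) ≠ 0 := fun l hl =>
      (mem_filter.mp hl).2.2
    have hZH : Z ⊆ H := filter_subset _ _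
    choose! B hB using hZp
    -- The partial petals form a sunflower with core `S` and smaller petals; `l ∉ T` makes them
    -- disjoint from `S`.
    refine (hN b hbr hb1 ι α c hc S B Z ?_ ?_ (fun l hl => (hB l hl).2.1)
      (fun l hl => (hB l hl).2.2)).le
    · exact fun l hl l' hl' h => (hdisj (hZH hl) (hZH hl') h).mono (hB l hl).1 (hB l' hl').1
    · intro l hl
      refine Disjoint.mono (mem_powerset.mp hS) (hB l hl).1 ?_
      rw [disjoint_union_left, disjoint_biUnion_left]
      refine ⟨hC l (hZH hl), fun l' hl' => hdisj (hT hl') (hZH hl) ?_⟩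
      rintro rfl
      exact (mem_filter.mp hl).2.1 hl'
  have hfree : ∀ L ⊆ H, #L ≤ d → ∀ l ∈ L, ∀ S ⊆ C ∪ (L.erase l).biUnion U, ∀ B ⊆ U l,
      B.Nonempty → B ≠ U l → c (S ∪ B) = 0 := by
    intro L hL hLd l hl S hS B hB hBne hBU
    by_contra hcB
    obtain ⟨q, hq⟩ : ∃ q, #L = q + 1 := Nat.exists_eq_succ_of_ne_zero (card_pos.mpr ⟨l, hl⟩).ne'
    -- One free set of the size of `L` suffices: by homogeneity all sets of that size have the same
    -- badness.
    obtain ⟨L₀, hL₀, hc₀, hL₀'⟩ := exists_free_set (H := H) (q := q) (D := D)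
      (Φ := fun T => {l ∈ H | l ∉ T ∧ Bad T l}) (fun T hT hTq => hcount T hT (by omega)) (by
        have : (q + 1) * D ≤ d * D := Nat.mul_le_mul_right _ (by omega)
        omega)
    have hbad := congrArg Prod.fst (hH L hL L₀ hL₀ (hq.trans hc₀.symm) (by omega))
    obtain ⟨l₀, hl₀, hb₀⟩ : ∃ l ∈ L₀, Bad (L₀.erase l) l :=
      hbad.mp ⟨l, hl, S, hS, B, hB, hBne, hBU, hcB⟩
    exact hL₀' l₀ hl₀ (mem_filter.mpr ⟨hL₀ hl₀, notMem_erase _ _, hb₀⟩)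
  have hhom : ∀ C' ⊆ C, ∀ L ⊆ H, ∀ L' ⊆ H, #L = #L' → #C' + r * #L ≤ k →
      ∑ S ∈ (C' ∪ L.biUnion U).powerset, c S = ∑ S ∈ (C' ∪ L'.biUnion U).powerset, c S := by
    intro C' hC' L hL L' hL' hLL hle
    have hLk : #L ≤ k := by nlinarith
    have h1 := congrFun (congrArg Prod.snd (hH L hL L' hL' hLL hLk)) ⟨C', mem_powerset.mpr hC'⟩
    have hA : ∀ L ⊆ H, #C' + r * #L ≤ k → ∑ S ∈ (C' ∪ L.biUnion U).powerset, c S ∈ A := by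
      intro L hL hle
      refine hc.mem _ ?_
      rwa [card_union_biUnion hdisj hC hr hC' hL]
    simp only [χ, dif_pos (hA L hL hle), dif_pos (hA L' hL' (hLL ▸ hle)), Subtype.mk.injEq] at h1
    exact h1
  obtain ⟨l, hl⟩ : H.Nonempty := card_pos.mp (by omega)
  refine hne l (hHI hl) ?_
  have := coeff_union_biUnion_eq_zero hdisj hC hr hr1 hk hc hcardC (by omega) hfree hhom C
    subset_rfl {l} (singleton_subset_iff.mpr hl) (singleton_nonempty l)
  rwa [singleton_biUnion] at this

/-- The classical sunflower argument: a maximal disjoint subfamily is a sunflower with core `C`,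
hence small, and every member meets its union. Moving a common point into the core lowers `r`, which
is why the core is arbitrary. -/
theorem exists_card_petals_le {A : Finset ℝ} {d k : ℕ} (hk : KappaConditions A d k) (r : ℕ) :
    ∃ m : ℕ, ∀ (ι : Type) [DecidableEq ι] (c : Finset ι → ℝ), IsBallFunction A d k c →
      ∀ (C : Finset ι) (𝓤 : Finset (Finset ι)), (∀ S ∈ 𝓤, Disjoint C S) → (∀ S ∈ 𝓤, #S = r) →
      (∀ S ∈ 𝓤, c (C ∪ S) ≠ 0) → #𝓤 ≤ m := by
  induction r with
  | zero =>
    refine ⟨1, fun ι _ c _ C 𝓤 _ h0 _ => ?_⟩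
    rw [card_le_one]
    intro S hS T hT
    rw [card_eq_zero.mp (h0 S hS), card_eq_zero.mp (h0 T hT)]
  | succ r ih =>
    obtain ⟨m, hm⟩ := ih
    obtain ⟨N, hN⟩ := exists_card_sunflower_lt hk (r + 1) (by omega)
    refine ⟨N * (r + 1) * m, fun ι _ c hc C 𝓤 hC hr hne => ?_⟩
    classical
    obtain ⟨𝓜, h𝓜, hmax⟩ := exists_max_image
      (𝓤.powerset.filter fun 𝓜 : Finset (Finset ι) => (𝓜 : Set (Finset ι)).PairwiseDisjoint id) card
      ⟨∅, by simp⟩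
    obtain ⟨h𝓜U, h𝓜d⟩ := mem_filter.mp h𝓜
    rw [mem_powerset] at h𝓜U
    have hcM : #𝓜 < N := hN ι (Finset ι) c hc C id 𝓜 h𝓜d (fun S hS => hC S (h𝓜U hS))
      (fun S hS => hr S (h𝓜U hS)) (fun S hS => hne S (h𝓜U hS))
    have hcov : 𝓤 ⊆ (𝓜.biUnion id).biUnion fun z => {S ∈ 𝓤 | z ∈ S} := by
      intro S hS
      simp only [mem_biUnion, mem_filter, id]
      by_contra hcon
      push Not at hcon
      have hSd : ∀ T ∈ 𝓜, Disjoint S T := fun T hT =>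
        disjoint_left.mpr fun z hzS hzT => hcon z ⟨T, hT, hzT⟩ hS hzS
      have hSM : S ∉ 𝓜 := by
        intro h
        have h1 := hSd S h
        rw [disjoint_self_iff_empty] at h1
        have h2 := hr S hS
        rw [h1] at h2
        simp at h2
      have h3 := hmax (insert S 𝓜) (by
        rw [mem_filter, mem_powerset]
        refine ⟨insert_subset hS h𝓜U, ?_⟩
        rw [coe_insert]
        exact h𝓜d.insert fun T hT _ => hSd T hT)
      rw [card_insert_of_notMem hSM] at h3
      omega
    refine (card_le_card hcov).trans ((card_biUnion_le_card_mul _ _ m fun z _ => ?_).trans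
      (Nat.mul_le_mul_right _ ?_))
    · have hinj : Set.InjOn (fun S : Finset ι => S.erase z) ({S ∈ 𝓤 | z ∈ S} : Finset _) := by
        intro S hS T hT h
        rw [← insert_erase (mem_filter.mp hS).2, ← insert_erase (mem_filter.mp hT).2]
        exact congrArg (insert z) h
      rw [← card_image_of_injOn hinj]
      refine hm ι c hc (insert z C) _ ?_ ?_ ?_
      all_goals
        intro T hT
        obtain ⟨S, hS, rfl⟩ := mem_image.mp hT
        obtain ⟨hSU, hzS⟩ := mem_filter.mp hS
      · rw [disjoint_insert_left]
        exact ⟨notMem_erase _ _, (hC S hSU).mono_right (erase_subset _ _)⟩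
      · rw [card_erase_of_mem hzS, hr S hSU]
        rfl
      · rw [insert_union, ← union_insert, insert_erase hzS]
        exact hne S hSU
    · refine (card_biUnion_le_card_mul _ _ (r + 1) fun S hS => ?_).trans
        (Nat.mul_le_mul_right _ hcM.le)
      exact (hr S (h𝓜U hS)).le

/-- An `A`-valued function of degree `d` on a ball of radius `k ≥ κ(A, d)` depends on a bounded
number of coordinates. -/
theorem exists_card_relevant_le {A : Finset ℝ} {d k : ℕ} (hk : KappaConditions A d k) :
    ∃ m : ℕ, ∀ (ι : Type) [DecidableEq ι] (c : Finset ι → ℝ), IsBallFunction A d k c →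
      ∀ Z : Finset ι, (∀ z ∈ Z, ∃ S, z ∈ S ∧ c S ≠ 0) → #Z ≤ m := by
  choose m hm using fun r => exists_card_petals_le hk r
  refine ⟨(∑ r ∈ range (d + 1), m r) * d, fun ι _ c hc Z hZ => ?_⟩
  choose! S hzS hS using hZ
  have hfam : #(Z.image S) ≤ ∑ r ∈ range (d + 1), m r := by
    rw [card_eq_sum_card_fiberwise (f := card) (t := range (d + 1))]
    · refine sum_le_sum fun r _ => hm r ι c hc ∅ _ (fun _ _ => disjoint_empty_left _)
        (fun T hT => (mem_filter.mp hT).2) fun T hT => ?_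
      obtain ⟨z, hz, rfl⟩ := mem_image.mp (mem_filter.mp hT).1
      rw [empty_union]
      exact hS z hz
    · intro T hT
      obtain ⟨z, hz, rfl⟩ := mem_image.mp hT
      simpa [Nat.lt_succ_iff] using hc.degree _ (hS z hz)
  have hcov : Z ⊆ (Z.image S).biUnion id := fun z hz =>
    mem_biUnion.mpr ⟨S z, mem_image_of_mem _ hz, hzS z hz⟩
  refine (card_le_card hcov).trans ((card_biUnion_le_card_mul _ _ d fun T hT => ?_).trans
    (Nat.mul_le_mul_right _ hfam))
  obtain ⟨z, hz, rfl⟩ := mem_image.mp hT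
  exact hc.degree _ (hS z hz)

/-! ### Points of the slice as finite sets -/

theorem Slice.finite_ones {ι : Type} {k : ℕ} (x : Slice ι k) : {i | x.1 i = true}.Finite :=
  Set.finite_of_encard_eq_coe x.2

/-- The set of coordinates of a point of the slice that are equal to one. -/
noncomputable def Slice.ones {ι : Type} {k : ℕ} (x : Slice ι k) : Finset ι :=
  x.finite_ones.toFinset

@[simp]
theorem Slice.mem_ones {ι : Type} {k : ℕ} {x : Slice ι k} {i : ι} : i ∈ x.ones ↔ x.1 i = true := by
  simp [Slice.ones]

theorem Slice.card_ones {ι : Type} {k : ℕ} (x : Slice ι k) : #x.ones = k := by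
  have h := x.2
  rw [x.finite_ones.encard_eq_coe_toFinset_card] at h
  exact_mod_cast h

theorem Slice.bit_eq {ι : Type} [DecidableEq ι] {k : ℕ} (x : Slice ι k) (i : ι) :
    x.bit i = if i ∈ x.ones then 1 else 0 := by
  simp [Slice.bit]

/-- The point of the slice with a given set of coordinates equal to one. -/
def Slice.ofFinset {ι : Type} [DecidableEq ι] {k : ℕ} (X : Finset ι) (h : #X = k) : Slice ι k :=
  ⟨fun i => decide (i ∈ X), by
    have : {i | decide (i ∈ X) = true} = (X : Set ι) := by
      ext i
      simp
    rw [this, Set.encard_coe_eq_coe_finsetCard, h]⟩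

@[simp]
theorem Slice.ones_ofFinset {ι : Type} [DecidableEq ι] {k : ℕ} (X : Finset ι) (h : #X = k) :
    (Slice.ofFinset X h).ones = X := by
  ext i
  exact Slice.mem_ones.trans (by simp [Slice.ofFinset])

theorem isJuntaOn_iff {ι : Type} {k : ℕ} {J : Finset ι} {f : Slice ι k → ℝ} :
    IsJuntaOn J f ↔ ∀ x y : Slice ι k, (∀ i ∈ J, x.1 i = y.1 i) → f x = f y := by
  constructor
  · rintro ⟨g, hg⟩ x y h
    rw [hg, hg]
    congr 1
    funext i
    exact h i i.2
  · intro h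
    obtain ⟨g, hg⟩ := (Function.factorsThrough_iff (f := fun (x : Slice ι k) (i : J) => x.1 i) f).mp
      fun x y hxy => h x y fun i hi => congrFun hxy ⟨i, hi⟩
    exact ⟨g, fun x => congrFun hg x⟩

/-! ### Alternating sums -/

/-- Toggling `i` pairs the terms with opposite signs. -/
theorem sum_powerset_neg_one_pow_mul_eq_zero {ι : Type} [DecidableEq ι] {g : Finset ι → ℝ}
    {S : Finset ι} {i : ι} (hi : i ∈ S) (h : ∀ T ⊆ S.erase i, g (insert i T) = g T) :
    ∑ T ∈ S.powerset, (-1) ^ #T * g T = 0 := by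
  rw [← insert_erase hi, sum_powerset_insert (notMem_erase i S), ← sum_add_distrib]
  refine sum_eq_zero fun T hT => ?_
  have hT := mem_powerset.mp hT
  rw [h T hT, card_insert_of_notMem fun hiT => notMem_erase i S (hT hiT)]
  ring

/-- A polynomial of degree less than `#S` has vanishing alternating sum over the subcube obtained
by exchanging the coordinates in `S` with other coordinates. -/
theorem sum_powerset_neg_one_pow_mul_eval_eq_zero {ι : Type} [DecidableEq ι]
    {Q : MvPolynomial ι ℝ} {S w : Finset ι} {e : ι → ι} (hQ : Q.totalDegree < #S)
    (he : Set.InjOn e S) (heS : ∀ i ∈ S, e i ∉ S) :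
    ∑ T ∈ S.powerset, (-1) ^ #T *
      MvPolynomial.eval (fun i => if i ∈ T ∪ ((S \ T).image e ∪ w) then 1 else 0) Q = 0 := by
  simp_rw [MvPolynomial.eval_eq, mul_sum]
  rw [sum_comm]
  refine sum_eq_zero fun m hm => ?_
  -- The `#S` pairs `{i, e i}` are disjoint and a monomial has fewer variables, so it misses one
  -- pair entirely and does not notice that exchange.
  obtain ⟨i, hi, him, heim⟩ : ∃ i ∈ S, i ∉ m.support ∧ e i ∉ m.support := by
    by_contra hcon
    push Not at hcon
    have h1 : #S ≤ #m.support := by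
      refine card_le_card_of_injOn (fun i => if i ∈ m.support then i else e i) ?_ ?_
      · intro i hi
        dsimp only
        split_ifs with h
        · exact h
        · exact hcon i hi h
      · intro i hi j hj hij
        dsimp only at hij
        split_ifs at hij with h h' h'
        · exact hij
        · exact absurd (hij ▸ hi) (heS j hj)
        · exact absurd (hij ▸ hj) (heS i hi)
        · exact he hi hj hij
    have h2 : #m.support ≤ m.sum fun _ a => a := by
      have := card_nsmul_le_sum m.support m 1 fun i hi =>
        Nat.one_le_iff_ne_zero.mpr (Finsupp.mem_support_iff.mp hi)
      simpa [Finsupp.sum] using this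
    have h3 := MvPolynomial.le_totalDegree hm
    omega
  refine sum_powerset_neg_one_pow_mul_eq_zero (g := fun T => Q.coeff m *
    ∏ j ∈ m.support, (if j ∈ T ∪ ((S \ T).image e ∪ w) then (1 : ℝ) else 0) ^ m j) hi
    fun T hT => ?_
  congr 1
  refine prod_congr rfl fun j hj => ?_
  have hji : j ≠ i := fun h => him (h ▸ hj)
  have hje : e i ≠ j := fun h => heim (h ▸ hj)
  have hiff : j ∈ insert i T ∪ ((S \ insert i T).image e ∪ w) ↔
      j ∈ T ∪ ((S \ T).image e ∪ w) := by
    simp only [mem_union, mem_insert, hji, false_or, mem_image, mem_sdiff, not_or]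
    refine or_congr_right (or_congr_left (exists_congr fun x => ?_))
    constructor
    · rintro ⟨⟨h1, _, h3⟩, h4⟩
      exact ⟨⟨h1, h3⟩, h4⟩
    · rintro ⟨⟨h1, h3⟩, rfl⟩
      exact ⟨⟨h1, fun h => hje (h ▸ rfl), h3⟩, rfl⟩
  simp only [hiff]

/-- Möbius inversion on the lattice of finite sets. -/
theorem sum_powerset_sum_powerset_neg_one_pow {ι : Type} [DecidableEq ι] (X : Finset ι) :
    ∀ F : Finset ι → ℝ,
      ∑ S ∈ X.powerset, (-1) ^ #S * ∑ T ∈ S.powerset, (-1) ^ #T * F T = F X := by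
  induction X using Finset.induction_on with
  | empty => simp
  | insert a X ha ih =>
    intro F
    rw [sum_powerset_insert ha, ih F]
    have : ∀ S ∈ X.powerset,
        (-1 : ℝ) ^ #(insert a S) * ∑ T ∈ (insert a S).powerset, (-1) ^ #T * F T =
        (-1) ^ #S * ∑ T ∈ S.powerset, (-1) ^ #T * (F (insert a T) - F T) := by
      intro S hS
      have haS : a ∉ S := fun h => ha (mem_powerset.mp hS h)
      rw [sum_powerset_insert haS, card_insert_of_notMem haS, ← sum_add_distrib, pow_succ,
        mul_assoc, mul_sum]
      congr 1
      refine sum_congr rfl fun T hT => ?_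
      rw [card_insert_of_notMem fun h => haS (mem_powerset.mp hT h)]
      ring
    rw [sum_congr rfl this, ih fun T => F (insert a T) - F T]
    ring

/-! ### From the slice to a ball -/

/-- Padding with a homogeneous set of coordinates turns a function on the slice into a function on
a ball. -/
theorem exists_isBallFunction {A : Finset ℝ} {d k : ℕ} {ι : Type} [DecidableEq ι]
    {Q : MvPolynomial ι ℝ} {G : Finset ι → ℝ}
    (hG : ∀ X, G X = MvPolynomial.eval (fun i => if i ∈ X then 1 else 0) Q)
    (hQ : Q.totalDegree ≤ d) (hA : ∀ X, #X = k → G X ∈ A) {V W : Finset ι} (hVW : Disjoint V W)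
    (hW : #W = k) (hhom : ∀ X ⊆ V, ∀ w ⊆ W, ∀ w' ⊆ W, #w = #w' → #X + #w = k →
      G (X ∪ w) = G (X ∪ w')) :
    ∃ c : Finset ι → ℝ, IsBallFunction A d k c ∧
      ∀ X ⊆ V, #X = k → ∑ S ∈ X.powerset, c S = G X := by
  have hpad : ∀ j : ℕ, ∃ w ⊆ W, j ≤ k → #w = j := by
    intro j
    by_cases hj : j ≤ k
    · obtain ⟨w, hw, hc⟩ := exists_subset_card_eq (hj.trans hW.ge)
      exact ⟨w, hw, fun _ => hc⟩
    · exact ⟨∅, empty_subset _, fun h => absurd h hj⟩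
  choose pad hpadW hpad using hpad
  set F : Finset ι → ℝ := fun X => G (X ∩ V ∪ pad (k - #(X ∩ V))) with hF
  have hFG : ∀ X ⊆ V, ∀ w ⊆ W, #X + #w = k → F X = G (X ∪ w) := by
    intro X hX w hw h
    simp only [hF, inter_eq_left.mpr hX]
    have hc := hpad (k - #X) (Nat.sub_le _ _)
    exact hhom X hX _ (hpadW _) w hw (by omega) (by omega)
  have hFA : ∀ X, #X ≤ k → F X ∈ A := by
    intro X hX
    have h1 : #(X ∩ V) ≤ k := (card_le_card inter_subset_left).trans hX
    refine hA _ ?_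
    rw [card_union_of_disjoint (hVW.mono inter_subset_right (hpadW _)),
      hpad _ (Nat.sub_le _ _)]
    omega
  have hzero : ∀ S, d < #S → #S ≤ k → ∑ T ∈ S.powerset, (-1) ^ #T * F T = 0 := by
    intro S hdS hSk
    by_cases hSV : S ⊆ V
    -- `W₀` holds an exchange partner for each element of `S`, and `w` fills up to weight `k`. By
    -- homogeneity this padding, which varies with `T`, gives the same values as `pad`.
    · obtain ⟨W₀, hW₀, hc₀⟩ := exists_subset_card_eq (hSk.trans hW.ge)
      obtain ⟨w, hw, hcw⟩ := exists_subset_card_eq (s := W \ W₀) (n := k - #S) (by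
        rw [card_sdiff_of_subset hW₀]
        omega)
      have hdW : Disjoint W₀ w := disjoint_of_subset_right hw disjoint_sdiff
      obtain ⟨e⟩ : Nonempty (S ≃ W₀) := ⟨equivOfCardEq hc₀.symm⟩
      set e' : ι → ι := fun i => if h : i ∈ S then e ⟨i, h⟩ else i with he'
      have heW : ∀ i ∈ S, e' i ∈ W₀ := fun i hi => by simp [he', hi]
      have hinj : Set.InjOn e' S := by
        intro i hi j hj hij
        simp only [he', dif_pos (mem_coe.mp hi), dif_pos (mem_coe.mp hj)] at hij
        simpa using e.injective (Subtype.ext hij)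
      rw [← sum_powerset_neg_one_pow_mul_eval_eq_zero (Q := Q) (S := S) (w := w) (e := e')
        (by omega) hinj fun i hi hiS => disjoint_left.mp hVW (hSV hiS) (hW₀ (heW i hi))]
      refine sum_congr rfl fun T hT => ?_
      have hTS := mem_powerset.mp hT
      have himg : (S \ T).image e' ⊆ W₀ := image_subset_iff.mpr fun i hi =>
        heW i (sdiff_subset hi)
      rw [← hG, hFG T (hTS.trans hSV) ((S \ T).image e' ∪ w)
        (union_subset (himg.trans hW₀) (hw.trans sdiff_subset))]
      rw [card_union_of_disjoint (disjoint_of_subset_left himg hdW),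
        card_image_of_injOn (hinj.mono (coe_subset.mpr sdiff_subset)), card_sdiff_of_subset hTS,
        hcw]
      have := card_le_card hTS
      omega
    · obtain ⟨i, hi, hiV⟩ := not_subset.mp hSV
      refine sum_powerset_neg_one_pow_mul_eq_zero hi fun T _ => ?_
      simp only [hF, insert_inter_of_notMem hiV]
  -- Möbius coefficients, truncated at `d`: those with `d < #S ≤ k` vanish by `hzero`, and larger
  -- sets do not affect the ball.
  set c : Finset ι → ℝ := fun S =>
    if #S ≤ d then (-1) ^ #S * ∑ T ∈ S.powerset, (-1) ^ #T * F T else 0 with hc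
  have hcF : ∀ X, #X ≤ k → ∑ S ∈ X.powerset, c S = F X := by
    intro X hX
    rw [← sum_powerset_sum_powerset_neg_one_pow X F]
    refine sum_congr rfl fun S hS => ?_
    simp only [hc]
    split_ifs with h
    · rfl
    · rw [hzero S (by omega) ((card_le_card (mem_powerset.mp hS)).trans hX), mul_zero]
  refine ⟨c, ⟨fun S hS => ?_, fun X hX => ?_⟩, fun X hX hXk => ?_⟩
  · by_contra h
    simp [hc, h] at hS
  · rw [hcF X hX]
    exact hFA X hX
  · rw [hcF X hXk.le, hFG X hX ∅ (empty_subset _) (by simpa using hXk), union_empty]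

theorem exists_coeff_ne_zero_of_ne {ι : Type} [DecidableEq ι] {c : Finset ι → ℝ} {T : Finset ι}
    {i j : ι} (hi : i ∉ T) (hj : j ∉ T)
    (h : ∑ S ∈ (insert i T).powerset, c S ≠ ∑ S ∈ (insert j T).powerset, c S) :
    ∃ S, (i ∈ S ∨ j ∈ S) ∧ c S ≠ 0 := by
  by_contra hcon
  push Not at hcon
  apply h
  rw [sum_powerset_insert hi, sum_powerset_insert hj]
  congr 1
  refine sum_congr rfl fun S _ => ?_
  rw [hcon _ (Or.inl (mem_insert_self i S)), hcon _ (Or.inr (mem_insert_self j S))]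

/-- Swapping an element of `X \ Y` for one of `Y \ X` moves `X` towards `Y`; both lie outside `J`
because the traces on `J` agree. -/
theorem eq_of_inter_eq_of_exchange {ι : Type} [DecidableEq ι] {k : ℕ} {G : Finset ι → ℝ}
    {J : Finset ι} (h : ∀ i ∉ J, ∀ j ∉ J, ∀ T : Finset ι, i ∉ T → j ∉ T → #T + 1 = k →
      G (insert i T) = G (insert j T)) {Y : Finset ι} (hY : #Y = k) :
    ∀ X : Finset ι, #X = k → X ∩ J = Y ∩ J → G X = G Y := by
  suffices hs : ∀ q : ℕ, ∀ X : Finset ι, #(X \ Y) = q → #X = k → X ∩ J = Y ∩ J → G X = G Y from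
    fun X => hs _ X rfl
  intro q
  induction q with
  | zero =>
    intro X hq hX _
    rw [eq_of_subset_of_card_le (sdiff_eq_empty_iff_subset.mp (card_eq_zero.mp hq))
      (hY.trans hX.symm).le]
  | succ q ih =>
    intro X hq hX hJ
    obtain ⟨i, hi⟩ : (X \ Y).Nonempty := card_pos.mp (by omega)
    obtain ⟨j, hj⟩ : (Y \ X).Nonempty := by
      rw [← card_pos, card_sdiff_comm (hY.trans hX.symm)]
      omega
    obtain ⟨hiX, hiY⟩ := mem_sdiff.mp hi
    obtain ⟨hjY, hjX⟩ := mem_sdiff.mp hj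
    have hiJ : i ∉ J := fun h => hiY (mem_of_mem_inter_left (hJ ▸ mem_inter.mpr ⟨hiX, h⟩))
    have hjJ : j ∉ J := fun h => hjX (mem_of_mem_inter_left (hJ.symm ▸ mem_inter.mpr ⟨hjY, h⟩))
    have hjT : j ∉ X.erase i := fun h => hjX (mem_of_mem_erase h)
    have hcT : #(X.erase i) + 1 = k := by
      rw [card_erase_add_one hiX, hX]
    have h1 := h i hiJ j hjJ (X.erase i) (notMem_erase i X) hjT hcT
    rw [insert_erase hiX] at h1
    rw [h1]
    refine ih _ ?_ (by rw [card_insert_of_notMem hjT, hcT]) ?_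
    · rw [insert_sdiff_of_mem _ hjY, erase_sdiff_comm, card_erase_of_mem hi, hq]
      rfl
    · rw [insert_inter_of_notMem hjJ, ← hJ]
      ext a
      simp only [mem_inter, mem_erase]
      refine ⟨fun ha => ⟨ha.1.2, ha.2⟩, fun ha => ⟨⟨?_, ha.1⟩, ha.2⟩⟩
      rintro rfl
      exact hiJ ha.2

/-- Either a function of `k`-sets is determined by the intersection with a small set, or there are
many disjoint pairs of elements whose exchange changes the function somewhere. -/
theorem exists_determining_set_or_sensitive_pairs {ι : Type} [DecidableEq ι] (k : ℕ)
    (G : Finset ι → ℝ) (M : ℕ) :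
    (∃ J : Finset ι, #J ≤ 2 * M ∧ ∀ X Y, #X = k → #Y = k → X ∩ J = Y ∩ J → G X = G Y) ∨
    ∃ 𝓟 : Finset (ι × ι), #𝓟 = M ∧
      (𝓟 : Set (ι × ι)).PairwiseDisjoint (fun p => ({p.1, p.2} : Finset ι)) ∧
      ∀ p ∈ 𝓟, ∃ T : Finset ι, p.1 ∉ T ∧ p.2 ∉ T ∧ #T + 1 = k ∧
        G (insert p.1 T) ≠ G (insert p.2 T) := by
  induction M with
  | zero => exact Or.inr ⟨∅, by simp⟩
  | succ M ih =>
    rcases ih with ⟨J, hJ, h⟩ | ⟨𝓟, hc, hd, hs⟩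
    · exact Or.inl ⟨J, by omega, h⟩
    · set J : Finset ι := 𝓟.biUnion fun p => {p.1, p.2} with hJ
      by_cases hex : ∀ i ∉ J, ∀ j ∉ J, ∀ T : Finset ι, i ∉ T → j ∉ T → #T + 1 = k →
          G (insert i T) = G (insert j T)
      · refine Or.inl ⟨J, ?_, fun X Y hX hY => eq_of_inter_eq_of_exchange hex hY X hX⟩
        have := card_biUnion_le_card_mul 𝓟 (fun p => ({p.1, p.2} : Finset ι)) 2
          fun p _ => card_le_two
        rw [hc, ← hJ] at this
        omega
      · push Not at hex
        obtain ⟨i, hi, j, hj, T, hiT, hjT, hT, hne⟩ := hex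
        have hdis : ∀ p ∈ 𝓟, Disjoint ({i, j} : Finset ι) {p.1, p.2} := by
          intro p hp
          refine Disjoint.mono_right (subset_biUnion_of_mem
            (fun p : ι × ι => ({p.1, p.2} : Finset ι)) hp) ?_
          rw [disjoint_insert_left, disjoint_singleton_left]
          exact ⟨hi, hj⟩
        have hnot : (i, j) ∉ 𝓟 := by
          intro h
          have := hdis _ h
          simp at this
        refine Or.inr ⟨insert (i, j) 𝓟, by rw [card_insert_of_notMem hnot, hc], ?_, ?_⟩
        · rw [coe_insert]
          exact hd.insert fun p hp _ => hdis p hp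
        · intro p hp
          rcases mem_insert.mp hp with rfl | hp
          · exact ⟨T, hiT, hjT, hT, hne⟩
          · exact hs p hp

theorem exists_isJunta_of_kappaConditions {A : Finset ℝ} {d k : ℕ} (hk : KappaConditions A d k) :
    ∃ m : ℕ, ∀ (n : ℕ) (f : Slice (Fin n) k → ℝ),
      IsValuedIn A f → HasDegreeLE d f → IsJunta m f := by
  obtain ⟨m₀, hm₀⟩ := exists_card_relevant_le hk
  -- Disjoint sensitive pairs yield distinct relevant coordinates, so `m₀ + 1` pairs are one too
  -- many.
  set M : ℕ := m₀ + 1 with hM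
  obtain ⟨R, hR⟩ := exists_ramsey (#A ^ 2 ^ (M * (k + 1))) k k
  refine ⟨max (2 * M) (M * (k + 1) + R), fun n f hfA ⟨Q, hQ, hf⟩ => ?_⟩
  rcases le_or_gt n (M * (k + 1) + R) with hn | hn
  · refine ⟨univ, by simpa using Or.inr hn, isJuntaOn_iff.mpr fun x y h => congrArg f ?_⟩
    exact Subtype.ext (funext fun i => h i (mem_univ i))
  set G : Finset (Fin n) → ℝ :=
    fun X => MvPolynomial.eval (fun i => if i ∈ X then 1 else 0) Q with hG
  have hfG : ∀ x, f x = G x.ones := by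
    intro x
    rw [hf]
    congr 2
    funext i
    exact x.bit_eq i
  have hGA : ∀ X, #X = k → G X ∈ A := by
    intro X hX
    have := hfA (Slice.ofFinset X hX)
    rwa [hfG, Slice.ones_ofFinset] at this
  rcases exists_determining_set_or_sensitive_pairs k G M with ⟨J, hJ, h⟩ | ⟨𝓟, hc, hd, hs⟩
  · refine ⟨J, hJ.trans (le_max_left _ _), isJuntaOn_iff.mpr fun x y hxy => ?_⟩
    rw [hfG, hfG]
    refine h _ _ x.card_ones y.card_ones ?_
    ext i
    simp only [mem_inter, Slice.mem_ones]
    exact and_congr_left fun hi => by rw [hxy i hi]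
  exfalso
  choose! T hT₁ hT₂ hTc hT using hs
  set V : Finset (Fin n) := 𝓟.biUnion fun p => insert p.1 (insert p.2 (T p)) with hV
  have hVc : #V ≤ M * (k + 1) := by
    rw [← hc]
    refine card_biUnion_le_card_mul _ _ _ fun p hp => ?_
    have h1 := card_insert_le p.1 (insert p.2 (T p))
    have h2 := card_insert_le p.2 (T p)
    have h3 := hTc p hp
    omega
  obtain ⟨p₀, hp₀⟩ : 𝓟.Nonempty := card_pos.mp (by omega)
  have a₀ : A := ⟨_, hGA (insert p₀.1 (T p₀)) (by
    rw [card_insert_of_notMem (hT₁ p₀ hp₀), hTc p₀ hp₀])⟩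
  obtain ⟨W, hWV, hWk, hW⟩ := hR (Fin n) ({X // X ∈ V.powerset} → A) (by
    rw [Fintype.card_fun, Fintype.card_coe, Fintype.card_coe, card_powerset]
    exact Nat.pow_le_pow_right (card_pos.mpr ⟨_, a₀.2⟩) (Nat.pow_le_pow_right (by norm_num) hVc))
    Vᶜ (fun w X => if h : G (X.1 ∪ w) ∈ A then ⟨_, h⟩ else a₀) (by
      rw [card_compl, Fintype.card_fin]
      omega)
  have hVW : Disjoint V W := disjoint_of_subset_right hWV disjoint_compl_right
  obtain ⟨c, hcB, hcG⟩ := exists_isBallFunction (G := G) (fun _ => rfl) hQ hGA hVW hWk (by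
    intro X hX w hw w' hw' hww hXw
    have h1 := congrFun (hW w hw w' hw' hww (by omega)) ⟨X, mem_powerset.mpr hX⟩
    have hA : ∀ w ⊆ W, #X + #w = k → G (X ∪ w) ∈ A := by
      intro w hw h
      refine hGA _ ?_
      rwa [card_union_of_disjoint (hVW.mono hX hw)]
    simp only [dif_pos (hA w hw hXw), dif_pos (hA w' hw' (hww ▸ hXw)), Subtype.mk.injEq] at h1
    exact h1)
  have hrel : ∀ p ∈ 𝓟, ∃ z ∈ ({p.1, p.2} : Finset (Fin n)), ∃ S, z ∈ S ∧ c S ≠ 0 := by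
    intro p hp
    have hsub : insert p.1 (insert p.2 (T p)) ⊆ V :=
      subset_biUnion_of_mem (fun p => insert p.1 (insert p.2 (T p))) hp
    have hne := hT p hp
    rw [← hcG (insert p.1 (T p)) ((insert_subset_insert _ (subset_insert _ _)).trans hsub)
        (by rw [card_insert_of_notMem (hT₁ p hp), hTc p hp]),
      ← hcG (insert p.2 (T p)) ((subset_insert _ _).trans hsub)
        (by rw [card_insert_of_notMem (hT₂ p hp), hTc p hp])] at hne
    obtain ⟨S, hS | hS, hcS⟩ := exists_coeff_ne_zero_of_ne (hT₁ p hp) (hT₂ p hp) hne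
    · exact ⟨p.1, by simp, S, hS, hcS⟩
    · exact ⟨p.2, by simp, S, hS, hcS⟩
  have : Nonempty (Fin n) := ⟨p₀.1⟩
  choose! z hz hzS using hrel
  have hcard : #(𝓟.image z) = M := by
    rw [card_image_of_injOn, hc]
    intro p hp p' hp' h
    exact hd.elim_finset hp hp' (z p) (hz p hp) (h ▸ hz p' hp')
  have := hm₀ (Fin n) c hcB (𝓟.image z) fun a ha => by
    obtain ⟨p, hp, rfl⟩ := mem_image.mp ha
    exact hzS p hp
  omega

/-! ### Set functions of bounded degree -/

/-- The function `X ↦ F X` on finite sets is a combination of the monomials `[S ⊆ X]` with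
`#S ≤ d`. -/
def HasSetDegreeLE {ι : Type} (d : ℕ) (F : Finset ι → ℝ) : Prop :=
  ∃ c : Finset ι → ℝ, (∀ S, c S ≠ 0 → #S ≤ d) ∧ ∀ X, F X = ∑ S ∈ X.powerset, c S

namespace HasSetDegreeLE

variable {ι : Type} {d e : ℕ} {F G : Finset ι → ℝ}

theorem mono (hF : HasSetDegreeLE d F) (h : d ≤ e) : HasSetDegreeLE e F :=
  let ⟨c, hc, hF⟩ := hF
  ⟨c, fun S hS => (hc S hS).trans h, hF⟩

theorem add (hF : HasSetDegreeLE d F) (hG : HasSetDegreeLE d G) :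
    HasSetDegreeLE d fun X => F X + G X := by
  obtain ⟨c, hc, hF⟩ := hF
  obtain ⟨b, hb, hG⟩ := hG
  refine ⟨fun S => c S + b S, fun S hS => ?_, fun X => by simp only [hF, hG, sum_add_distrib]⟩
  by_cases h : c S = 0
  · exact hb S fun h' => hS (by simp only [h, h', add_zero])
  · exact hc S h

theorem card_filter_subset (p : Finset ι → Prop) [DecidablePred p] (hp : ∀ S, p S → #S ≤ d) :
    HasSetDegreeLE d fun X => (#{S ∈ X.powerset | p S} : ℝ) := by
  refine ⟨fun S => if p S then 1 else 0, fun S hS => hp S ?_, fun X => by simp⟩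
  by_contra h
  simp [h] at hS

theorem const (a : ℝ) : HasSetDegreeLE d fun _ : Finset ι => a := by
  classical
  refine ⟨fun S => if S = ∅ then a else 0, fun S hS => ?_, fun X => ?_⟩
  · by_contra h
    have : S ≠ ∅ := by
      rintro rfl
      simp at h
    simp [this] at hS
  · rw [sum_ite_eq', if_pos (empty_mem_powerset X)]

theorem subset [DecidableEq ι] (T : Finset ι) :
    HasSetDegreeLE #T fun X => if T ⊆ X then (1 : ℝ) else 0 := by
  refine ⟨fun S => if S = T then 1 else 0, fun S hS => ?_, fun X => ?_⟩
  · by_contra h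
    have : S ≠ T := by
      rintro rfl
      simp at h
    simp [this] at hS
  · simp [sum_ite_eq']

/-- The product of the monomials of `S` and `T` is the monomial of `S ∪ T`; the coefficients are
collected by unions. -/
theorem mul (hF : HasSetDegreeLE d F) (hG : HasSetDegreeLE e G) :
    HasSetDegreeLE (d + e) fun X => F X * G X := by
  classical
  obtain ⟨c, hc, hF⟩ := hF
  obtain ⟨b, hb, hG⟩ := hG
  refine ⟨fun S => ∑ p ∈ S.powerset ×ˢ S.powerset with p.1 ∪ p.2 = S, c p.1 * b p.2,
    fun S hS => ?_, fun X => ?_⟩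
  · obtain ⟨p, hp, hne⟩ := exists_ne_zero_of_sum_ne_zero hS
    rw [← (mem_filter.mp hp).2]
    exact (card_union_le _ _).trans (add_le_add (hc _ (left_ne_zero_of_mul hne))
      (hb _ (right_ne_zero_of_mul hne)))
  · dsimp only
    rw [hF, hG, sum_mul_sum, ← sum_product',
      ← sum_fiberwise_of_maps_to (t := X.powerset) (g := fun p => p.1 ∪ p.2)]
    · refine sum_congr rfl fun S hS => sum_congr ?_ fun _ _ => rfl
      have hSX := mem_powerset.mp hS
      ext p
      simp only [mem_filter, mem_product, mem_powerset]
      constructor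
      · rintro ⟨-, rfl⟩
        exact ⟨⟨subset_union_left, subset_union_right⟩, rfl⟩
      · rintro ⟨⟨h1, h2⟩, h3⟩
        exact ⟨⟨h1.trans hSX, h2.trans hSX⟩, h3⟩
    · intro p hp
      simp only [mem_product, mem_powerset] at hp ⊢
      exact union_subset hp.1 hp.2

theorem pow (hF : HasSetDegreeLE d F) (s : ℕ) : HasSetDegreeLE (d * s) fun X => F X ^ s := by
  induction s with
  | zero => simpa using const 1
  | succ s ih =>
    simp only [pow_succ]
    exact ih.mul hF

theorem sum {κ : Type} (I : Finset κ) {F : κ → Finset ι → ℝ}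
    (hF : ∀ i ∈ I, HasSetDegreeLE d (F i)) : HasSetDegreeLE d fun X => ∑ i ∈ I, F i X := by
  classical
  induction I using Finset.induction_on with
  | empty => simpa using const 0
  | insert a I ha ih =>
    simp only [sum_insert ha]
    exact (hF a (mem_insert_self a I)).add (ih fun i hi => hF i (mem_insert_of_mem hi))

theorem eval (hF : HasSetDegreeLE d F) {P : Polynomial ℝ} {s : ℕ} (hP : P.natDegree ≤ s) :
    HasSetDegreeLE (d * s) fun X => P.eval (F X) := by
  simp only [Polynomial.eval_eq_sum_range]
  refine sum _ fun i hi => ?_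
  have h := (const (d := 0) (P.coeff i)).mul (hF.pow i)
  rw [zero_add] at h
  exact h.mono (Nat.mul_le_mul_left _ ((Nat.lt_succ_iff.mp (mem_range.mp hi)).trans hP))

end HasSetDegreeLE

theorem Slice.prod_bit {ι : Type} [DecidableEq ι] {k : ℕ} (x : Slice ι k) (S : Finset ι) :
    ∏ i ∈ S, x.bit i = if S ⊆ x.ones then 1 else 0 := by
  simp only [Slice.bit_eq, prod_boole]
  rfl

theorem HasSetDegreeLE.hasDegreeLEInfinite {d k : ℕ} {F : Finset ℕ → ℝ}
    (hF : HasSetDegreeLE d F) : HasDegreeLEInfinite d fun x : Slice ℕ k => F x.ones := by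
  obtain ⟨c, hc, hF⟩ := hF
  refine ⟨fun S => c S.1, fun x => ?_⟩
  have h : F x.ones = ∑ S ∈ x.ones.powerset.subtype (fun S => #S ≤ d),
      c S.1 * ∏ i ∈ S.1, x.bit i := by
    rw [sum_subtype_eq_sum_filter (f := fun S => c S * ∏ i ∈ S, x.bit i), hF,
      sum_filter_of_ne fun S _ h => hc S (left_ne_zero_of_mul h)]
    refine sum_congr rfl fun S hS => ?_
    rw [Slice.prod_bit, if_pos (mem_powerset.mp hS), mul_one]
  simp only [h]
  refine hasSum_sum_of_ne_finset_zero fun S hS => ?_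
  rw [Slice.prod_bit, if_neg fun h => hS (by simpa using h), mul_zero]

theorem HasSetDegreeLE.hasDegreeLE {d k : ℕ} {F : Finset ℕ → ℝ} (hF : HasSetDegreeLE d F)
    (n : ℕ) : HasDegreeLE d fun x : Slice (Fin n) k => F (x.ones.map Fin.valEmbedding) := by
  obtain ⟨c, hc, hF⟩ := hF
  refine ⟨∑ S : Finset (Fin n), MvPolynomial.C (c (S.map Fin.valEmbedding)) *
    ∏ i ∈ S, MvPolynomial.X i, ?_, fun x => ?_⟩
  · refine MvPolynomial.totalDegree_finsetSum_le fun S _ => ?_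
    by_cases h : c (S.map Fin.valEmbedding) = 0
    · simp [h]
    · refine (MvPolynomial.totalDegree_mul _ _).trans ?_
      rw [MvPolynomial.totalDegree_C, zero_add]
      refine (MvPolynomial.totalDegree_finsetProd _ _).trans ?_
      simpa using hc _ h
  · simp only [map_sum, map_mul, MvPolynomial.eval_C, map_prod, MvPolynomial.eval_X,
      Slice.prod_bit, mul_ite, mul_one, mul_zero]
    rw [hF, ← sum_filter]
    symm
    refine sum_bij (fun S _ => S.map Fin.valEmbedding) (fun S hS => ?_)
      (fun S _ S' _ h => map_injective _ h) (fun S hS => ?_) (fun _ _ => rfl)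
    · simpa using hS
    · obtain ⟨S', hS', rfl⟩ := subset_map_iff.mp (mem_powerset.mp hS)
      exact ⟨S', by simpa using hS', rfl⟩

/-! ### Functions that are not juntas -/

/-- Pairs of `k`-sets on which `F` differs, such that the `j`-th pair differs only inside the
`j`-th member of a disjoint family. -/
structure IsDisjointlySensitive (k : ℕ) (F : Finset ℕ → ℝ) (X Y D : ℕ → Finset ℕ) : Prop where
  card_left : ∀ j, #(X j) = k
  card_right : ∀ j, #(Y j) = k
  ne : ∀ j, F (X j) ≠ F (Y j)
  disjoint : Pairwise (Function.onFun Disjoint D)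
  agree : ∀ j, ∀ i ∉ D j, i ∈ X j ↔ i ∈ Y j

theorem exists_disjoint_of_card_le {D : ℕ → Finset ℕ} (hD : Pairwise (Function.onFun Disjoint D))
    {J : Finset ℕ} {m : ℕ} (hJ : #J ≤ m) : ∃ j ≤ m, Disjoint J (D j) := by
  by_contra hcon
  push Not at hcon
  have h : ∀ j, ∃ i, j ≤ m → i ∈ J ∧ i ∈ D j := by
    intro j
    by_cases hj : j ≤ m
    · obtain ⟨i, hi⟩ := not_disjoint_iff.mp (hcon j hj)
      exact ⟨i, fun _ => hi⟩
    · exact ⟨0, fun h => absurd h hj⟩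
  choose g hg using h
  have := card_le_card_of_injOn (s := range (m + 1)) (t := J) g
    (fun j hj => (hg j (by simpa [Nat.lt_succ_iff] using hj)).1) (by
      intro j hj j' hj' h
      by_contra hne
      have h1 := (hg j (by simpa [Nat.lt_succ_iff] using hj)).2
      have h2 := (hg j' (by simpa [Nat.lt_succ_iff] using hj')).2
      exact disjoint_left.mp (hD hne) h1 (h ▸ h2))
  rw [card_range] at this
  omega

namespace IsDisjointlySensitive

variable {k : ℕ} {F : Finset ℕ → ℝ} {X Y D : ℕ → Finset ℕ}

theorem not_isJunta (h : IsDisjointlySensitive k F X Y D) (m : ℕ) :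
    ¬ IsJunta m fun x : Slice ℕ k => F x.ones := by
  rintro ⟨J, hJ, hf⟩
  obtain ⟨j, -, hj⟩ := exists_disjoint_of_card_le h.disjoint hJ
  have := isJuntaOn_iff.mp hf (Slice.ofFinset (X j) (h.card_left j))
    (Slice.ofFinset (Y j) (h.card_right j)) fun i hi => by
      simp only [Slice.ofFinset, h.agree j i (disjoint_left.mp hj hi)]
  simp only [Slice.ones_ofFinset] at this
  exact h.ne j this

theorem exists_not_isJunta (h : IsDisjointlySensitive k F X Y D) (m : ℕ) :
    ∃ n, k ≤ n ∧ ¬ IsJunta m fun x : Slice (Fin n) k => F (x.ones.map Fin.valEmbedding) := by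
  -- The first `m + 1` pairs already defeat every set of `m` coordinates, so `n` need only contain
  -- these.
  obtain ⟨n, hn⟩ : ∃ n, (range (m + 1)).biUnion (fun j => X j ∪ Y j) ⊆ range n := by
    obtain ⟨n, hn⟩ := exists_nat_subset_range ((range (m + 1)).biUnion fun j => X j ∪ Y j)
    exact ⟨n, hn⟩
  have hmap : ∀ Z : Finset ℕ, Z ⊆ range n →
      ({i : Fin n | (i : ℕ) ∈ Z} : Finset (Fin n)).map Fin.valEmbedding = Z := by
    intro Z hZ
    ext i
    simp only [mem_map, mem_filter, mem_univ, true_and, Fin.valEmbedding_apply]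
    constructor
    · rintro ⟨a, ha, rfl⟩
      exact ha
    · exact fun hi => ⟨⟨i, mem_range.mp (hZ hi)⟩, hi, rfl⟩
  have hX : ∀ j ≤ m, X j ⊆ range n := fun j hj => subset_union_left.trans
    ((subset_biUnion_of_mem (fun j => X j ∪ Y j) (mem_range.mpr (Nat.lt_succ_of_le hj))).trans hn)
  have hY : ∀ j ≤ m, Y j ⊆ range n := fun j hj => subset_union_right.trans
    ((subset_biUnion_of_mem (fun j => X j ∪ Y j) (mem_range.mpr (Nat.lt_succ_of_le hj))).trans hn)
  refine ⟨n, ?_, ?_⟩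
  · have := card_le_card (hX 0 (Nat.zero_le _))
    rwa [h.card_left, card_range] at this
  rintro ⟨J, hJ, hf⟩
  obtain ⟨j, hjm, hj⟩ := exists_disjoint_of_card_le h.disjoint (J := J.map Fin.valEmbedding)
    (m := m) (by rwa [card_map])
  have := isJuntaOn_iff.mp hf
    (Slice.ofFinset {i : Fin n | (i : ℕ) ∈ X j}
      (by rw [← card_map Fin.valEmbedding, hmap _ (hX j hjm), h.card_left]))
    (Slice.ofFinset {i : Fin n | (i : ℕ) ∈ Y j}
      (by rw [← card_map Fin.valEmbedding, hmap _ (hY j hjm), h.card_right]))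
    fun i hi => by
      have h1 := h.agree j i (disjoint_left.mp hj (mem_map_of_mem Fin.valEmbedding hi))
      simp [Slice.ofFinset, h1]
  simp only [Slice.ones_ofFinset, hmap _ (hX j hjm), hmap _ (hY j hjm)] at this
  exact h.ne j this

end IsDisjointlySensitive

/-! ### Functions of blocks of coordinates -/

/-- A set of `m` natural numbers; the sets with distinct labels `(a, l)` are disjoint. -/
def cell (a l m : ℕ) : Finset ℕ :=
  (range m).image fun j => Nat.pair a (Nat.pair l j)

theorem mem_cell {i a l m : ℕ} : i ∈ cell a l m ↔
    (Nat.unpair i).1 = a ∧ (Nat.unpair (Nat.unpair i).2).1 = l ∧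
      (Nat.unpair (Nat.unpair i).2).2 < m := by
  simp only [cell, mem_image, mem_range]
  constructor
  · rintro ⟨j, hj, rfl⟩
    simpa using hj
  · rintro ⟨rfl, rfl, h⟩
    exact ⟨_, h, by simp⟩

theorem card_cell (a l m : ℕ) : #(cell a l m) = m := by
  rw [cell, card_image_of_injective, card_range]
  intro j j' h
  simpa [Nat.pair_eq_pair] using h

theorem disjoint_cell {a l m a' l' m' : ℕ} (h : a ≠ a' ∨ l ≠ l') :
    Disjoint (cell a l m) (cell a' l' m') := by
  rw [disjoint_left]
  intro i hi hi'
  rw [mem_cell] at hi hi'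
  rcases h with h | h
  · exact h (hi.1.symm.trans hi'.1)
  · exact h (hi.2.1.symm.trans hi'.2.1)

open Classical in
/-- The number of blocks `cell 1 l r` contained in `X`. -/
noncomputable def blockCount (r : ℕ) (X : Finset ℕ) : ℕ :=
  #{S ∈ X.powerset | ∃ l, S = cell 1 l r}

theorem blockCount_eq {r : ℕ} (hr : 1 ≤ r) {X L : Finset ℕ}
    (h : ∀ l, cell 1 l r ⊆ X ↔ l ∈ L) : blockCount r X = #L := by
  classical
  have hinj : Function.Injective fun l => cell 1 l r := by
    intro l l' hl
    have h0 : Nat.pair 1 (Nat.pair l 0) ∈ cell 1 l r := by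
      rw [mem_cell]
      simpa using Nat.pos_of_ne_zero (by omega)
    dsimp only at hl
    rw [hl, mem_cell] at h0
    simpa using h0.2.1
  rw [blockCount, ← card_image_of_injective L hinj]
  congr 1
  ext S
  simp only [mem_filter, mem_powerset, mem_image]
  constructor
  · rintro ⟨hS, l, rfl⟩
    exact ⟨l, (h l).mp hS, rfl⟩
  · rintro ⟨l, hl, rfl⟩
    exact ⟨(h l).mpr hl, l, rfl⟩

/-- This packing bound keeps the block count within the range where `P` is known to take values in
`A`. -/
theorem add_mul_blockCount_le {t r : ℕ} {X : Finset ℕ} (hT : cell 0 0 t ⊆ X) :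
    t + r * blockCount r X ≤ #X := by
  classical
  set 𝓑 : Finset (Finset ℕ) := {S ∈ X.powerset | ∃ l, S = cell 1 l r} with h𝓑
  have hB : ∀ S ∈ 𝓑, S ⊆ X ∧ ∃ l, S = cell 1 l r := fun S hS => by
    simpa [h𝓑] using hS
  have hdis : (𝓑 : Set (Finset ℕ)).PairwiseDisjoint id := by
    intro S hS S' hS' hne
    obtain ⟨l, rfl⟩ := (hB S hS).2
    obtain ⟨l', rfl⟩ := (hB S' hS').2
    exact disjoint_cell (Or.inr fun h => hne (h ▸ rfl))
  have hcard : #(𝓑.biUnion id) = r * #𝓑 := by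
    rw [card_biUnion hdis, mul_comm, ← smul_eq_mul, ← sum_const]
    refine sum_congr rfl fun S hS => ?_
    obtain ⟨l, rfl⟩ := (hB S hS).2
    exact card_cell 1 l r
  have hTB : Disjoint (cell 0 0 t) (𝓑.biUnion id) := by
    rw [disjoint_biUnion_right]
    intro S hS
    obtain ⟨l, rfl⟩ := (hB S hS).2
    exact disjoint_cell (Or.inl zero_ne_one)
  have hb : blockCount r X = #𝓑 := by
    rw [blockCount, h𝓑]
  rw [hb, ← hcard]
  conv_lhs => rw [← card_cell 0 0 t]
  rw [← card_union_of_disjoint hTB]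
  exact card_le_card (union_subset hT (biUnion_subset.mpr fun S hS => (hB S hS).1))

/-- The value `P b` at sets containing `t` fixed coordinates and `b` blocks of size `r`, and
`P 0` at other sets. -/
noncomputable def blockFunction (t r : ℕ) (P : Polynomial ℝ) (X : Finset ℕ) : ℝ :=
  P.eval 0 + (if cell 0 0 t ⊆ X then 1 else 0) * (P.eval (blockCount r X : ℝ) + -P.eval 0)

theorem hasSetDegreeLE_blockFunction {t r s : ℕ} {P : Polynomial ℝ} (hP : P.natDegree ≤ s) :
    HasSetDegreeLE (t + r * s) (blockFunction t r P) := by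
  classical
  have h1 : HasSetDegreeLE r fun X => (blockCount r X : ℝ) := by
    refine HasSetDegreeLE.card_filter_subset (fun S => ∃ l, S = cell 1 l r) ?_
    rintro S ⟨l, rfl⟩
    exact (card_cell 1 l r).le
  have h2 := HasSetDegreeLE.subset (cell 0 0 t)
  rw [card_cell] at h2
  exact (HasSetDegreeLE.const _).add (h2.mul ((h1.eval hP).add (HasSetDegreeLE.const _)))

theorem blockFunction_mem {A : Finset ℝ} {t r k : ℕ} (hr : 1 ≤ r) {P : Polynomial ℝ}
    (hA : ∀ i : ℕ, i ≤ (k - t) / r → P.eval (i : ℝ) ∈ A) {X : Finset ℕ} (hX : #X = k) :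
    blockFunction t r P X ∈ A := by
  rw [blockFunction]
  split_ifs with h
  · have h1 := add_mul_blockCount_le (r := r) h
    have h2 := hA (blockCount r X) (by
      rw [Nat.le_div_iff_mul_le hr, mul_comm]
      omega)
    simpa using h2
  · simpa using hA 0 (Nat.zero_le _)

theorem exists_eval_ne_eval_succ {P : Polynomial ℝ} {s N : ℕ} (hP : P.natDegree ≤ s) (hs : s ≤ N)
    (hne : ¬ ∃ c : ℝ, P = Polynomial.C c) :
    ∃ y : ℕ, y + 1 ≤ N ∧ P.eval (y : ℝ) ≠ P.eval ((y + 1 : ℕ) : ℝ) := by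
  by_contra hcon
  push Not at hcon
  have hval : ∀ i : ℕ, i ≤ N → P.eval (i : ℝ) = P.eval 0 := by
    intro i
    induction i with
    | zero => simp
    | succ i ih => exact fun hi => (hcon i hi).symm.trans (ih (by omega))
  refine hne ⟨P.eval 0, sub_eq_zero.mp ?_⟩
  refine Polynomial.eq_zero_of_natDegree_lt_card_of_eval_eq_zero' _
    ((range (N + 1)).image (fun i : ℕ => (i : ℝ))) ?_ ?_
  · intro x hx
    obtain ⟨i, hi, rfl⟩ := mem_image.mp hx
    simp [hval i (by simpa [Nat.lt_succ_iff] using hi)]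
  · rw [card_image_of_injective _ Nat.cast_injective, Polynomial.natDegree_sub_C, card_range]
    omega

theorem exists_isDisjointlySensitive_blockFunction {t r s k : ℕ} (hr : 1 ≤ r)
    (hk : t + r * s ≤ k) {P : Polynomial ℝ} (hP : P.natDegree ≤ s)
    (hne : ¬ ∃ c : ℝ, P = Polynomial.C c) :
    ∃ X Y D, IsDisjointlySensitive k (blockFunction t r P) X Y D := by
  obtain ⟨y, hy, hPy⟩ := exists_eval_ne_eval_succ (N := (k - t) / r) hP (by
    rw [Nat.le_div_iff_mul_le hr, mul_comm]
    omega) hne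
  rw [Nat.le_div_iff_mul_le hr, add_mul, one_mul] at hy
  set u : ℕ := k - t - (y * r + r) with hu
  -- Label 0 marks the fixed coordinates, 1 the blocks, 2 replacements that never form a block, and
  -- 3 filler. Adding to `Z` a new block or a replacement of the same size gives block count `y + 1`
  -- or `y`.
  set Z : Finset ℕ := cell 0 0 t ∪ ((range y).biUnion (fun l => cell 1 l r) ∪ cell 3 0 u) with hZ
  have hZc : #Z + r = k := by
    rw [hZ, card_union_of_disjoint, card_union_of_disjoint, card_biUnion, card_cell, card_cell,
      sum_congr rfl fun l _ => card_cell 1 l r, sum_const, card_range, smul_eq_mul]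
    · rcases Nat.lt_or_ge k t with h | h <;> omega
    · exact fun l _ l' _ h => disjoint_cell (Or.inr h)
    · rw [disjoint_biUnion_left]
      exact fun l _ => disjoint_cell (Or.inl (by norm_num))
    · rw [disjoint_union_right, disjoint_biUnion_right]
      exact ⟨fun l _ => disjoint_cell (Or.inl (by norm_num)),
        disjoint_cell (Or.inl (by norm_num))⟩
  have hZB : ∀ j, Disjoint Z (cell 1 (y + j) r) := by
    intro j
    rw [hZ, disjoint_union_left, disjoint_union_left, disjoint_biUnion_left]
    refine ⟨disjoint_cell (Or.inl (by norm_num)), fun l hl => disjoint_cell (Or.inr ?_),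
      disjoint_cell (Or.inl (by norm_num))⟩
    have := mem_range.mp hl
    omega
  have hZQ : ∀ j, Disjoint Z (cell 2 j r) := by
    intro j
    rw [hZ, disjoint_union_left, disjoint_union_left, disjoint_biUnion_left]
    exact ⟨disjoint_cell (Or.inl (by norm_num)), fun l _ => disjoint_cell (Or.inl (by norm_num)),
      disjoint_cell (Or.inl (by norm_num))⟩
  have hTZ : cell 0 0 t ⊆ Z := subset_union_left
  have hBZ : ∀ l < y, cell 1 l r ⊆ Z := fun l hl =>
    (subset_biUnion_of_mem (fun l => cell 1 l r) (mem_range.mpr hl)).trans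
      (subset_union_left.trans subset_union_right)
  have hmem : ∀ l, Nat.pair 1 (Nat.pair l 0) ∈ cell 1 l r := by
    intro l
    rw [mem_cell]
    simpa using Nat.pos_of_ne_zero (by omega)
  have hmemZ : ∀ l, Nat.pair 1 (Nat.pair l 0) ∈ Z → l < y := by
    intro l hl
    have h : l < y ∧ r ≠ 0 := by simpa [hZ, mem_cell, Nat.pos_iff_ne_zero] using hl
    exact h.1
  have hcX : ∀ j, blockCount r (Z ∪ cell 1 (y + j) r) = y + 1 := by
    intro j
    rw [blockCount_eq hr (L := insert (y + j) (range y)), card_insert_of_notMem (by simp),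
      card_range]
    intro l
    rw [mem_insert, mem_range]
    constructor
    · intro h
      rcases mem_union.mp (h (hmem l)) with h | h
      · exact Or.inr (hmemZ l h)
      · left
        simpa using (mem_cell.mp h).2.1
    · rintro (rfl | h)
      · exact subset_union_right
      · exact (hBZ l h).trans subset_union_left
  have hcY : ∀ j, blockCount r (Z ∪ cell 2 j r) = y := by
    intro j
    rw [blockCount_eq hr (L := range y), card_range]
    intro l
    rw [mem_range]
    constructor
    · intro h
      rcases mem_union.mp (h (hmem l)) with h | h
      · exact hmemZ l h
      · have := (mem_cell.mp h).1
        simp at this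
    · exact fun h => (hBZ l h).trans subset_union_left
  refine ⟨fun j => Z ∪ cell 1 (y + j) r, fun j => Z ∪ cell 2 j r,
    fun j => cell 1 (y + j) r ∪ cell 2 j r, ?_, ?_, ?_, ?_, ?_⟩
  · intro j
    rw [card_union_of_disjoint (hZB j), card_cell, hZc]
  · intro j
    rw [card_union_of_disjoint (hZQ j), card_cell, hZc]
  · intro j
    simp only [blockFunction, hcX, hcY, if_pos (hTZ.trans subset_union_left), one_mul]
    intro h
    exact hPy (by linarith)
  · intro j j' hj
    simp only [Function.onFun, disjoint_union_left, disjoint_union_right]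
    exact ⟨⟨disjoint_cell (Or.inr (by omega)), disjoint_cell (Or.inl (by norm_num))⟩,
      disjoint_cell (Or.inl (by norm_num)), disjoint_cell (Or.inr hj)⟩
  · intro j i hi
    rw [mem_union, not_or] at hi
    simp only [mem_union, hi.1, hi.2]

end JuntaSlice

theorem theorem3p1 (A : Finset ℝ) (hA : 2 ≤ A.card) (d : ℕ) (hd : 1 ≤ d) :
    IsLeast {κ : ℕ | JuntaSlice.KappaConditions A d κ} (JuntaSlice.kappa A d) ∧
    (∀ k : ℕ, JuntaSlice.kappa A d ≤ k →
      ∃ m : ℕ, ∀ (n : ℕ) (f : JuntaSlice.Slice (Fin n) k → ℝ),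
        JuntaSlice.IsValuedIn A f → JuntaSlice.HasDegreeLE d f → JuntaSlice.IsJunta m f) ∧
    (∀ k : ℕ, 1 ≤ k → k < JuntaSlice.kappa A d →
      (∀ m : ℕ, 1 ≤ m → ∃ n : ℕ, k ≤ n ∧ ∃ f : JuntaSlice.Slice (Fin n) k → ℝ,
        JuntaSlice.IsValuedIn A f ∧ JuntaSlice.HasDegreeLE d f ∧ ¬ JuntaSlice.IsJunta m f) ∧
      (∃ f : JuntaSlice.Slice ℕ k → ℝ,
        JuntaSlice.IsValuedIn A f ∧ JuntaSlice.HasDegreeLEInfinite d f ∧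
          ∀ m : ℕ, ¬ JuntaSlice.IsJunta m f)) := by
  refine ⟨JuntaSlice.isLeast_kappa A d,
    fun k hk => JuntaSlice.exists_isJunta_of_kappaConditions
      ((JuntaSlice.isLeast_kappa A d).1.mono hk),
    fun k hk1 hk => ?_⟩
  obtain ⟨t, r, s, hr, htd, htk, P, hP, hPA, hne⟩ :=
    JuntaSlice.exists_nonconstant_of_lt_kappa hA hk1 hk
  -- One set function on finite subsets of `ℕ` serves both claims: its restriction to `Fin n` and
  -- its values on the infinite slice.
  have hdeg := (JuntaSlice.hasSetDegreeLE_blockFunction (t := t) (r := r) hP).mono htd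
  obtain ⟨X, Y, D, hXY⟩ := JuntaSlice.exists_isDisjointlySensitive_blockFunction hr htk hP hne
  refine ⟨fun m _ => ?_, _, fun x => JuntaSlice.blockFunction_mem hr hPA x.card_ones,
    hdeg.hasDegreeLEInfinite, hXY.not_isJunta⟩
  obtain ⟨n, hkn, hn⟩ := hXY.exists_not_isJunta m
  exact ⟨n, hkn, _, fun x => JuntaSlice.blockFunction_mem hr hPA (by rw [Finset.card_map, x.card_ones]),
    hdeg.hasDegreeLE n, hn⟩
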